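/- Let $N\ge 1$ be an integer, $p>1$, $M>0$, and set $\beta=1/(p-1)$ and $q^*=N(p-1)/2$. There exist constants $\eta_1,k_1>0$, depending only on $M,p,N$, with the following property. Let $\Omega\subset\mathbb{R}^N$ be any smooth (possibly unbounded) domain, let $u_0\in L^\infty(\Omega)$, and let $u$ be the maximal classical solution of $$u_t=\Delta u+|u|^{p-1}u \ \text{ in } (0,T)\times\Omega,\qquad u=0 \ \text{ on } (0,T)\times\partial\Omega,\qquad u(0,\cdot)=u_0 \ \text{ in } \Omega.$$ Here a classical solution is of class $C^{1,2}$ in $(0,T)\times\Omega$, continuous on $(0,T)\times\overline\Omega$, bounded on $(0,T')\times\Omega$ for every $T'<T$, and $u(t,\cdot)\to u_0$ as $t\to0^+$ in $L^1(\Omega\cap B_R(0))$ for every $R>0$. Assume that the maximal existence time $T$ is finite and that $$\|u(t)\|_{L^\infty(\Omega)}\le M(T-t)^{-\beta},\qquad 0\le t<T.$$ Then for every blow-up point $a$ of $u$, that is, every $a\in\overline\Omega$ with $\limsup_{t\to T,\,x\to a}|u(t,x)|=\infty$, we have $$\int_{\Omega\cap\{|x-a|\le k_1\sqrt{T-t}\}}|u(t,x)|^{q^*}\,dx\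 \ge\ \eta_1\qquad\text{for all } 0\le t<T.$$ -/

import Mathlib

open MeasureTheory Filter Topology Set
open scoped ContDiff ENNReal

namespace SemilinearHeat

/-- A smooth, possibly unbounded domain: a nonempty connected open set which, near each of its
boundary points, is the sublevel set `{φ < 0}` of a smooth function `φ` with nonvanishing
differential at that point. -/
structure IsSmoothDomain {N : ℕ} (Ω : Set (EuclideanSpace ℝ (Fin N))) : Prop where
  isOpen : IsOpen Ω
  isConnected : IsConnected Ω
  smooth_boundary : ∀ a ∈ frontier Ω, ∃ U ∈ 𝓝 a, ∃ φ : EuclideanSpace ℝ (Fin N) → ℝ,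
    ContDiff ℝ ∞ φ ∧ fderiv ℝ φ a ≠ 0 ∧ Ω ∩ U = {x | φ x < 0} ∩ U

/-- `u` is a classical solution on `[0, T)` of the Dirichlet problem
`u_t = Δu + |u|^(p-1) u` in `Ω`, `u = 0` on `∂Ω`, `u(0) = u₀`, where `u₀ ∈ L^∞(Ω)`.

The solution is `C^{1,2}` in `(0, T) × Ω`, continuous on `(0, T) × closure Ω` and bounded on
`(0, T') × Ω` for each `T' < T`. As `u₀` is merely bounded, it is attained in the sense of
`L¹` on bounded subsets of `Ω`. -/
structure IsClassicalSolution {N : ℕ} (p : ℝ) (Ω : Set (EuclideanSpace ℝ (Fin N)))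
    (u₀ : EuclideanSpace ℝ (Fin N) → ℝ) (T : ℝ)
    (u : ℝ → EuclideanSpace ℝ (Fin N) → ℝ) : Prop where
  contDiffOn_space : ∀ t ∈ Ioo 0 T, ContDiffOn ℝ 2 (u t) Ω
  differentiableAt_time : ∀ t ∈ Ioo 0 T, ∀ x ∈ Ω, DifferentiableAt ℝ (fun s => u s x) t
  continuousOn_deriv_time :
    ContinuousOn (fun z : ℝ × EuclideanSpace ℝ (Fin N) => deriv (fun s => u s z.2) z.1)
      (Ioo 0 T ×ˢ Ω)
  continuousOn_fderiv_space :
    ContinuousOn (fun z : ℝ × EuclideanSpace ℝ (Fin N) => fderiv ℝ (u z.1) z.2)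
      (Ioo 0 T ×ˢ Ω)
  continuousOn_iteratedFDeriv_space :
    ContinuousOn (fun z : ℝ × EuclideanSpace ℝ (Fin N) => iteratedFDeriv ℝ 2 (u z.1) z.2)
      (Ioo 0 T ×ˢ Ω)
  continuousOn_closure :
    ContinuousOn (fun z : ℝ × EuclideanSpace ℝ (Fin N) => u z.1 z.2) (Ioo 0 T ×ˢ closure Ω)
  locally_bounded : ∀ T' < T, ∃ C : ℝ, ∀ t ∈ Ioo 0 T', ∀ x ∈ Ω, |u t x| ≤ C
  equation : ∀ t ∈ Ioo 0 T, ∀ x ∈ Ω,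
    deriv (fun s => u s x) t = Laplacian.laplacian (u t) x + |u t x| ^ (p - 1) * u t x
  boundary : ∀ t ∈ Ioo 0 T, ∀ x ∈ frontier Ω, u t x = 0
  initial : u 0 =ᵐ[volume.restrict Ω] u₀
  initial_limit : ∀ R > 0,
    Tendsto (fun t => ∫⁻ x in Ω ∩ Metric.ball 0 R, ‖u t x - u₀ x‖ₑ) (𝓝[>] 0) (𝓝 0)

/-- `u` is a blow-up solution with blow-up time `T`: it is the maximal classical solution for the
initial data `u₀`, and its maximal existence time is the finite number `T > 0`. -/
structure IsBlowUpSolution {N : ℕ} (p : ℝ) (Ω : Set (EuclideanSpace ℝ (Fin N)))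
    (u₀ : EuclideanSpace ℝ (Fin N) → ℝ) (T : ℝ)
    (u : ℝ → EuclideanSpace ℝ (Fin N) → ℝ) : Prop where
  time_pos : 0 < T
  isClassicalSolution : IsClassicalSolution p Ω u₀ T u
  maximal : ∀ T' > T, ¬ ∃ v, IsClassicalSolution p Ω u₀ T' v

/-- The type I estimate `‖u(t)‖_∞ ≤ M (T - t)^(-β)` for `0 ≤ t < T`, where `β = 1 / (p - 1)`. -/
def TypeIEstimate {N : ℕ} (p : ℝ) (Ω : Set (EuclideanSpace ℝ (Fin N))) (T M : ℝ)
    (u : ℝ → EuclideanSpace ℝ (Fin N) → ℝ) : Prop :=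
  ∀ t ∈ Ico 0 T, eLpNorm (u t) ⊤ (volume.restrict Ω) ≤
    ENNReal.ofReal (M * (T - t) ^ (-(1 / (p - 1))))

/-- `a ∈ closure Ω` is a blow-up point of `u` at time `T`:
`limsup |u(t, x)| = ∞` as `t → T`, `x → a` with `t < T`, `x ∈ Ω`. -/
def IsBlowUpPoint {N : ℕ} (Ω : Set (EuclideanSpace ℝ (Fin N))) (T : ℝ)
    (u : ℝ → EuclideanSpace ℝ (Fin N) → ℝ) (a : EuclideanSpace ℝ (Fin N)) : Prop :=
  a ∈ closure Ω ∧
    limsup (fun z : ℝ × EuclideanSpace ℝ (Fin N) => ‖u z.1 z.2‖ₑ) (𝓝[<] T ×ˢ 𝓝[Ω] a) = ⊤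

end SemilinearHeat

/-!
Translating and rescaling parabolically, one may assume that the blow-up time is `1`, the point is
`0` and the initial time is `0`. Suppose that the initial mass `∫ |u|` on a large ball is small. On
a time interval `[0, t₀]` with `t₀ < 1` the solution is bounded, so `|u|` lies below `exp (C t) W`,
where `W` is caloric: finitely many heat kernels carrying the initial mass, plus a multiple of
`‖x - b‖² + 2Nt` which is large on the lateral boundary and small at the centre. Hence `|u|` is
small at time `t₀` near `0`. From then on it is confined by an explicit barrier growing like a power
of `‖x - b‖² / (1 - t)`: where the barrier is small the reaction term is negligible, and elsewhere
it is controlled by the type I estimate. So `u` stays bounded near `0` up to time `1`, and `0` is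
not a blow-up point. The resulting lower bound for the mass holds for every initial time in `(0, T)`
and extends to `0` by the `L¹` convergence to the initial data. It becomes a lower bound for the
integral of `|u|^q*`, since the type I estimate bounds `|u|` on the ball.
-/

namespace SemilinearHeat

open Laplacian Metric

section Laplacian

theorem deriv_deriv_nonpos_of_isLocalMax {g : ℝ → ℝ} {s : ℝ} (hmax : IsLocalMax g s)
    (hg : ContinuousAt g s) : deriv (deriv g) s ≤ 0 := by
  by_contra! hpos
  have hmin : IsLocalMin g s := isLocalMin_of_deriv_deriv_pos hpos hmax.deriv_eq_zero hg
  have hconst : g =ᶠ[𝓝 s] fun _ => g s := by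
    filter_upwards [hmax, hmin] with r h₁ h₂ using le_antisymm h₁ h₂
  have hzero : deriv (deriv g) s = 0 := by simp [hconst.deriv.deriv_eq]
  exact hpos.ne' hzero

section NormedSpace

variable {E F : Type*} [NormedAddCommGroup E] [NormedSpace ℝ E] [NormedAddCommGroup F]
  [NormedSpace ℝ F]

theorem deriv_deriv_comp_line {f : E → F} {x : E} (hf : ContDiffAt ℝ 2 f x) (e : E) :
    deriv (deriv fun s : ℝ => f (x + s • e)) 0 = iteratedFDeriv ℝ 2 f x ![e, e] := by
  have hline (s : ℝ) : HasDerivAt (fun s : ℝ => x + s • e) e s := by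
    simpa using ((hasDerivAt_id s).smul_const e).const_add x
  have hcont : Tendsto (fun s : ℝ => x + s • e) (𝓝 0) (𝓝 x) := by
    simpa using (hline 0).continuousAt.tendsto
  have hfirst : (deriv fun s : ℝ => f (x + s • e)) =ᶠ[𝓝 0] fun s => fderiv ℝ f (x + s • e) e := by
    filter_upwards [hcont.eventually (hf.eventually (by simp))] with s hs
    exact ((hs.differentiableAt (by simp)).hasFDerivAt.comp_hasDerivAt s (hline s)).deriv
  have hfderiv : HasFDerivAt (fderiv ℝ f) (fderiv ℝ (fderiv ℝ f) x) (x + (0 : ℝ) • e) := by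
    simpa using ((hf.fderiv_right (m := 1) (by norm_num)).differentiableAt (by simp)).hasFDerivAt
  rw [hfirst.deriv_eq, iteratedFDeriv_two_apply]
  exact ((ContinuousLinearMap.apply ℝ F e).hasFDerivAt.comp_hasDerivAt (0 : ℝ)
    (hfderiv.comp_hasDerivAt (0 : ℝ) (hline 0))).deriv

theorem fderiv_comp_affine (f : E → F) (a : E) (r : ℝ) (x : E) :
    fderiv ℝ (fun y => f (a + r • y)) x = r • fderiv ℝ f (a + r • x) := by
  rw [← fderiv_comp_add_left (f := f)]
  exact fderiv_comp_smul (f := fun y => f (a + y)) r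

end NormedSpace

variable {E : Type*} [NormedAddCommGroup E] [InnerProductSpace ℝ E]

theorem hasFDerivAt_norm_sub_sq (b x : E) :
    HasFDerivAt (fun y => ‖y - b‖ ^ 2) (2 • innerSL ℝ (x - b)) x := by
  simpa using ((hasFDerivAt_id x).sub_const b).norm_sq

variable [FiniteDimensional ℝ E] {f : E → ℝ} {x b : E}

theorem laplacian_nonpos_of_isLocalMax (hf : ContDiffAt ℝ 2 f x) (hmax : IsLocalMax f x) :
    Δ f x ≤ 0 := by
  rw [InnerProductSpace.laplacian_eq_iteratedFDeriv_stdOrthonormalBasis]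
  refine Finset.sum_nonpos fun i _ => ?_
  set e := stdOrthonormalBasis ℝ E i
  have hline : Tendsto (fun s : ℝ => x + s • e) (𝓝 0) (𝓝 x) :=
    Continuous.tendsto' (by fun_prop) 0 x (by simp)
  rw [← deriv_deriv_comp_line hf]
  refine deriv_deriv_nonpos_of_isLocalMax ?_ ?_
  · filter_upwards [hline.eventually hmax] with s hs
    simpa using hs
  · simpa [ContinuousAt, Function.comp_def] using hf.continuousAt.tendsto.comp hline

theorem laplacian_comp_affine (f : E → ℝ) (a : E) (r : ℝ) (x : E) :
    Δ (fun y => f (a + r • y)) x = r ^ 2 * Δ f (a + r • x) := by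
  simp only [InnerProductSpace.laplacian_eq_iteratedFDeriv_stdOrthonormalBasis,
    iteratedFDeriv_two_apply, Finset.mul_sum]
  refine Finset.sum_congr rfl fun i _ => ?_
  have hsecond : fderiv ℝ (fun y => r • fderiv ℝ f (a + r • y)) x =
      r • r • fderiv ℝ (fderiv ℝ f) (a + r • x) := by
    rw [← fderiv_comp_affine]
    exact congrFun (fderiv_const_smul_field (𝕜 := ℝ) (f := fun y => fderiv ℝ f (a + r • y)) r) x
  rw [funext (fderiv_comp_affine f a r), hsecond]
  simp only [Matrix.cons_val_zero, Matrix.cons_val_one, _root_.smul_apply, smul_eq_mul]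
  ring

theorem laplacian_comp_norm_sub_sq {g g' : ℝ → ℝ} {d : ℝ}
    (hg : ∀ᶠ ρ in 𝓝 (‖x - b‖ ^ 2), HasDerivAt g (g' ρ) ρ)
    (hg' : HasDerivAt g' d (‖x - b‖ ^ 2)) :
    Δ (fun y => g (‖y - b‖ ^ 2)) x =
      4 * ‖x - b‖ ^ 2 * d + 2 * Module.finrank ℝ E * g' (‖x - b‖ ^ 2) := by
  have hcont : ContinuousAt (fun y => ‖y - b‖ ^ 2) x := by fun_prop
  have hfirst : fderiv ℝ (fun y => g (‖y - b‖ ^ 2)) =ᶠ[𝓝 x]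
      (fun y => g' (‖y - b‖ ^ 2)) • fun y => 2 • innerSL ℝ (y - b) := by
    filter_upwards [hcont.eventually hg] with y hy
    exact (hy.comp_hasFDerivAt y (hasFDerivAt_norm_sub_sq b y)).fderiv
  have hinner : HasFDerivAt (fun y => 2 • innerSL ℝ (y - b)) (2 • innerSL ℝ) x :=
    ((innerSL ℝ).hasFDerivAt.comp x ((hasFDerivAt_id x).sub_const b)).const_smul 2
  have hsecond := (hg'.comp_hasFDerivAt x (hasFDerivAt_norm_sub_sq b x)).smul hinner
  have hterm (i) : iteratedFDeriv ℝ 2 (fun y => g (‖y - b‖ ^ 2)) x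
      ![stdOrthonormalBasis ℝ E i, stdOrthonormalBasis ℝ E i] =
      4 * d * inner ℝ (x - b) (stdOrthonormalBasis ℝ E i) ^ 2 + 2 * g' (‖x - b‖ ^ 2) := by
    rw [iteratedFDeriv_two_apply, hfirst.fderiv_eq,
      show fderiv ℝ ((fun y => g' (‖y - b‖ ^ 2)) • fun y => 2 • innerSL ℝ (y - b)) x = _
        from hsecond.fderiv]
    change g' _ * (2 • inner ℝ (stdOrthonormalBasis ℝ E i) (stdOrthonormalBasis ℝ E i)) +
      d * (2 • inner ℝ (x - b) (stdOrthonormalBasis ℝ E i)) *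
        (2 • inner ℝ (x - b) (stdOrthonormalBasis ℝ E i)) = _
    rw [real_inner_self_eq_norm_sq, (stdOrthonormalBasis ℝ E).norm_eq_one]
    ring
  have hsum : ∑ i, inner ℝ (x - b) (stdOrthonormalBasis ℝ E i) ^ 2 = ‖x - b‖ ^ 2 := by
    simpa using (stdOrthonormalBasis ℝ E).sum_sq_norm_inner_left (x - b)
  simp only [InnerProductSpace.laplacian_eq_iteratedFDeriv_stdOrthonormalBasis, hterm,
    Finset.sum_add_distrib, ← Finset.mul_sum, hsum, Finset.sum_const, Finset.card_univ,
    Fintype.card_fin, nsmul_eq_mul]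
  ring

end Laplacian

section Comparison

theorem exists_first_zero {X : Type*} [TopologicalSpace X] {K : Set X} {w : ℝ → X → ℝ}
    {t₀ t₁ : ℝ} (hK : IsCompact K)
    (hw : ContinuousOn (Function.uncurry w) (Icc t₀ t₁ ×ˢ K)) (hinit : ∀ x ∈ K, w t₀ x < 0)
    (hne : ∃ t ∈ Icc t₀ t₁, ∃ x ∈ K, 0 ≤ w t x) :
    ∃ t ∈ Ioc t₀ t₁, ∃ x ∈ K, w t x = 0 ∧ (∀ y ∈ K, w t y ≤ 0) ∧
      ∀ s ∈ Ico t₀ t, ∀ y ∈ K, w s y < 0 := by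
  obtain ⟨s₀, hs₀, y₀, hy₀, hsy⟩ := hne
  set S := (Icc t₀ t₁ ×ˢ K) ∩ Function.uncurry w ⁻¹' Ici 0
  have hS : IsCompact S := by
    obtain ⟨C, hC, hCeq⟩ := continuousOn_iff_isClosed.1 hw (Ici 0) isClosed_Ici
    rw [show S = _ from (inter_comm _ _).trans hCeq]
    exact (isCompact_Icc.prod hK).inter_left hC
  obtain ⟨⟨t, x⟩, ⟨⟨ht, hx⟩, hpos⟩, hmin⟩ := hS.exists_isMinOn ⟨(s₀, y₀), ⟨hs₀, hy₀⟩, hsy⟩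
    continuous_fst.continuousOn
  simp only [mem_preimage, mem_Ici, Function.uncurry_apply_pair] at ht hx hpos
  have hbefore : ∀ s ∈ Ico t₀ t, ∀ y ∈ K, w s y < 0 := by
    intro s hs y hy
    by_contra! h
    exact hs.2.not_ge (hmin (a := (s, y)) ⟨⟨⟨hs.1, hs.2.le.trans ht.2⟩, hy⟩, h⟩)
  have ht₀ : t₀ < t := ht.1.lt_of_ne fun h => (hinit x hx).not_ge (h ▸ hpos)
  have hnow : ∀ y ∈ K, w t y ≤ 0 := by
    intro y hy
    have hcont : ContinuousWithinAt (fun s => w s y) (Ico t₀ t) t :=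
      (hw (t, y) ⟨ht, hy⟩).comp (f := fun s => (s, y)) (by fun_prop)
        fun s hs => ⟨⟨hs.1, hs.2.le.trans ht.2⟩, hy⟩
    have hne : (𝓝[Ico t₀ t] t).NeBot := by
      rw [← mem_closure_iff_nhdsWithin_neBot, closure_Ico ht₀.ne]
      exact right_mem_Icc.2 ht₀.le
    refine le_of_tendsto hcont ?_
    filter_upwards [self_mem_nhdsWithin] with s hs using (hbefore s hs y hy).le
  exact ⟨t, ⟨ht₀, ht.2⟩, x, hx, (hnow x hx).antisymm hpos, hnow, hbefore⟩

theorem deriv_nonneg_of_eventually_le_left {g : ℝ → ℝ} {t : ℝ} (hg : DifferentiableAt ℝ g t)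
    (hle : ∀ᶠ s in 𝓝[<] t, g s ≤ g t) : 0 ≤ deriv g t := by
  refine ge_of_tendsto (hg.hasDerivAt.tendsto_slope.mono_left (nhdsLT_le_nhdsNE t)) ?_
  filter_upwards [hle, self_mem_nhdsWithin] with s hs hst
  rw [slope_def_field]
  exact div_nonneg_of_nonpos (sub_nonpos.2 hs) (sub_nonpos.2 (le_of_lt hst))

variable {E : Type*} [NormedAddCommGroup E] [InnerProductSpace ℝ E] [FiniteDimensional ℝ E]

theorem neg_of_strict_subsolution {K U : Set E} {w : ℝ → E → ℝ} {t₀ t₁ : ℝ} (hK : IsCompact K)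
    (hU : IsOpen U) (hUK : U ⊆ K)
    (hw : ContinuousOn (Function.uncurry w) (Icc t₀ t₁ ×ˢ K)) (hinit : ∀ x ∈ K, w t₀ x < 0)
    (hlat : ∀ t ∈ Icc t₀ t₁, ∀ x ∈ K \ U, w t x < 0)
    (htime : ∀ t ∈ Ioc t₀ t₁, ∀ x ∈ U, DifferentiableAt ℝ (fun s => w s x) t)
    (hspace : ∀ t ∈ Ioc t₀ t₁, ∀ x ∈ U, ContDiffAt ℝ 2 (w t) x)
    (hsub : ∀ t ∈ Ioc t₀ t₁, ∀ x ∈ U, w t x = 0 → deriv (fun s => w s x) t < Δ (w t) x) :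
    ∀ t ∈ Icc t₀ t₁, ∀ x ∈ K, w t x < 0 := by
  by_contra! hne
  obtain ⟨t, ht, x, hx, hzero, hnow, hbefore⟩ := exists_first_zero hK hw hinit hne
  have hxU : x ∈ U := by
    by_contra h
    exact (hlat t (Ioc_subset_Icc_self ht) x ⟨hx, h⟩).ne hzero
  have hspace_le : Δ (w t) x ≤ 0 := by
    refine laplacian_nonpos_of_isLocalMax (hspace t ht x hxU) ?_
    filter_upwards [hU.mem_nhds hxU] with y hy using hzero ▸ hnow y (hUK hy)
  have htime_le : 0 ≤ deriv (fun s => w s x) t := by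
    refine deriv_nonneg_of_eventually_le_left (htime t ht x hxU) ?_
    filter_upwards [Ico_mem_nhdsLT ht.1] with s hs using hzero ▸ (hbefore s hs x hx).le
  exact (hsub t ht x hxU hzero).not_ge (hspace_le.trans htime_le)

/-- A classical solution on `[0, T)` of the Dirichlet problem for `v_t = Δv + |v|^(p-1) v` in `Ω`
which is continuous up to the initial time. -/
structure IsRegularSolution (p T : ℝ) (Ω : Set E) (v : ℝ → E → ℝ) : Prop where
  isOpen : IsOpen Ω
  continuousOn : ContinuousOn (Function.uncurry v) (Ico 0 T ×ˢ closure Ω)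
  boundary : ∀ t ∈ Ico 0 T, ∀ x ∈ frontier Ω, v t x = 0
  differentiableAt_time : ∀ t ∈ Ioo 0 T, ∀ x ∈ Ω, DifferentiableAt ℝ (fun s => v s x) t
  contDiffAt_space : ∀ t ∈ Ioo 0 T, ∀ x ∈ Ω, ContDiffAt ℝ 2 (v t) x
  equation : ∀ t ∈ Ioo 0 T, ∀ x ∈ Ω,
    deriv (fun s => v s x) t = Δ (v t) x + |v t x| ^ (p - 1) * v t x

/-- A positive function on the cylinder `[t₀, t₁] × closedBall b R` which dominates every solution
of the Dirichlet problem that starts below it and is bounded by `B t` at time `t`: it exceeds `B`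
on the lateral boundary, and is a strict supersolution of `z_t = Δz + z^p` wherever it does not
exceed `B`. -/
structure IsStrictBarrier (p : ℝ) (B : ℝ → ℝ) (b : E) (R t₀ t₁ : ℝ) (z : ℝ → E → ℝ) : Prop where
  continuousOn : ContinuousOn (Function.uncurry z) (Icc t₀ t₁ ×ˢ closedBall b R)
  pos : ∀ t ∈ Icc t₀ t₁, ∀ x ∈ closedBall b R, 0 < z t x
  lateral : ∀ t ∈ Icc t₀ t₁, ∀ x ∈ sphere b R, B t < z t x
  differentiableAt_time : ∀ t ∈ Ioc t₀ t₁, ∀ x ∈ ball b R, DifferentiableAt ℝ (fun s => z s x) t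
  contDiffAt_space : ∀ t ∈ Ioc t₀ t₁, ∀ x ∈ ball b R, ContDiffAt ℝ 2 (z t) x
  supersolution : ∀ t ∈ Ioc t₀ t₁, ∀ x ∈ ball b R, z t x ≤ B t →
    Δ (z t) x + z t x ^ (p - 1) * z t x < deriv (fun s => z s x) t

namespace IsRegularSolution

variable {p T R t₀ t₁ : ℝ} {B : ℝ → ℝ} {b : E} {Ω : Set E} {v z : ℝ → E → ℝ}

theorem neg (hv : IsRegularSolution p T Ω v) : IsRegularSolution p T Ω (fun t x => -v t x) where
  isOpen := hv.isOpen
  continuousOn := hv.continuousOn.neg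
  boundary t ht x hx := by simp [hv.boundary t ht x hx]
  differentiableAt_time t ht x hx := (hv.differentiableAt_time t ht x hx).neg
  contDiffAt_space t ht x hx := (hv.contDiffAt_space t ht x hx).neg
  equation t ht x hx := by
    have hlap : Δ (fun y => -v t y) x = -Δ (v t) x := congrFun InnerProductSpace.laplacian_neg x
    rw [deriv.fun_neg, hlap, hv.equation t ht x hx, abs_neg]
    ring

theorem continuousOn_space {t : ℝ} (hv : IsRegularSolution p T Ω v) (ht : t ∈ Ico 0 T) :
    ContinuousOn (v t) (closure Ω) :=
  hv.continuousOn.comp (f := fun x : E => (t, x)) (by fun_prop) fun _ hx => ⟨ht, hx⟩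

theorem continuous_indicator_abs {t : ℝ} (hv : IsRegularSolution p T Ω v) (ht : t ∈ Ico 0 T) :
    Continuous (Ω.indicator fun x => |v t x|) :=
  continuous_indicator (fun x hx => by simp only [hv.boundary t ht x hx, abs_zero])
    (hv.continuousOn_space ht).abs

theorem indicator_abs {t : ℝ} (hv : IsRegularSolution p T Ω v) (ht : t ∈ Ico 0 T) {x : E}
    (hx : x ∈ closure Ω) :
    Ω.indicator (fun x => |v t x|) x = |v t x| := by
  rw [indicator_apply_eq_self]
  intro hxΩ
  rw [hv.boundary t ht x (hv.isOpen.frontier_eq ▸ ⟨hx, hxΩ⟩), abs_zero]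

theorem lt_of_isStrictBarrier (hv : IsRegularSolution p T Ω v) (ht₀ : 0 ≤ t₀) (ht₁ : t₁ < T)
    (hB : ∀ t ∈ Icc t₀ t₁, ∀ x ∈ closure Ω, |v t x| ≤ B t)
    (hz : IsStrictBarrier p B b R t₀ t₁ z)
    (hinit : ∀ x ∈ closedBall b R ∩ closure Ω, v t₀ x < z t₀ x) :
    ∀ t ∈ Icc t₀ t₁, ∀ x ∈ closedBall b R ∩ closure Ω, v t x < z t x := by
  have hIco : Icc t₀ t₁ ⊆ Ico 0 T := fun t ht => ⟨ht₀.trans ht.1, ht.2.trans_lt ht₁⟩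
  have hIoo : Ioc t₀ t₁ ⊆ Ioo 0 T := fun t ht => ⟨ht₀.trans_lt ht.1, ht.2.trans_lt ht₁⟩
  suffices ∀ t ∈ Icc t₀ t₁, ∀ x ∈ closedBall b R ∩ closure Ω, v t x - z t x < 0 from
    fun t ht x hx => sub_neg.1 (this t ht x hx)
  refine neg_of_strict_subsolution (w := fun t x => v t x - z t x) (U := ball b R ∩ Ω)
    ((isCompact_closedBall b R).inter_right isClosed_closure) (isOpen_ball.inter hv.isOpen)
    (inter_subset_inter ball_subset_closedBall subset_closure)
    ((hv.continuousOn.mono (prod_mono hIco inter_subset_right)).sub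
      (hz.continuousOn.mono (prod_mono subset_rfl inter_subset_left)))
    (fun x hx => sub_neg.2 (hinit x hx)) ?lateral
    (fun t ht x hx => (hv.differentiableAt_time t (hIoo ht) x hx.2).sub
      (hz.differentiableAt_time t ht x hx.1))
    (fun t ht x hx => (hv.contDiffAt_space t (hIoo ht) x hx.2).sub
      (hz.contDiffAt_space t ht x hx.1)) ?interior
  case lateral =>
    rintro t ht x ⟨⟨hxb, hxΩ⟩, hxU⟩
    by_cases hx : x ∈ Ω
    · have hsphere : x ∈ sphere b R := hxb.antisymm (not_lt.1 fun h => hxU ⟨h, hx⟩)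
      linarith [le_abs_self (v t x), hB t ht x hxΩ, hz.lateral t ht x hsphere]
    · have hfrontier : x ∈ frontier Ω := by rw [hv.isOpen.frontier_eq]; exact ⟨hxΩ, hx⟩
      linarith [hv.boundary t (hIco ht) x hfrontier, hz.pos t ht x hxb]
  case interior =>
    rintro t ht x ⟨hxb, hxΩ⟩ hzero
    have hIcc : t ∈ Icc t₀ t₁ := Ioc_subset_Icc_self ht
    have hvz : v t x = z t x := sub_eq_zero.1 hzero
    have hle : z t x ≤ B t := hvz ▸ (le_abs_self _).trans (hB t hIcc x (subset_closure hxΩ))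
    have heq := hv.equation t (hIoo ht) x hxΩ
    rw [hvz, abs_of_pos (hz.pos t hIcc x (ball_subset_closedBall hxb))] at heq
    have hlap : Δ (fun y => v t y - z t y) x = Δ (v t) x - Δ (z t) x :=
      (hv.contDiffAt_space t (hIoo ht) x hxΩ).laplacian_sub (hz.contDiffAt_space t ht x hxb)
    rw [deriv_fun_sub (hv.differentiableAt_time t (hIoo ht) x hxΩ)
      (hz.differentiableAt_time t ht x hxb), hlap]
    linarith [hz.supersolution t ht x hxb hle]

theorem abs_lt_of_isStrictBarrier (hv : IsRegularSolution p T Ω v) (ht₀ : 0 ≤ t₀) (ht₁ : t₁ < T)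
    (hB : ∀ t ∈ Icc t₀ t₁, ∀ x ∈ closure Ω, |v t x| ≤ B t)
    (hz : IsStrictBarrier p B b R t₀ t₁ z)
    (hinit : ∀ x ∈ closedBall b R ∩ closure Ω, |v t₀ x| < z t₀ x) :
    ∀ t ∈ Icc t₀ t₁, ∀ x ∈ closedBall b R ∩ closure Ω, |v t x| < z t x := fun t ht x hx =>
  abs_lt.2 ⟨neg_lt.1 (hv.neg.lt_of_isStrictBarrier ht₀ ht₁ (by simpa using hB) hz
      (fun y hy => neg_lt.1 (abs_lt.1 (hinit y hy)).1) t ht x hx),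
    hv.lt_of_isStrictBarrier ht₀ ht₁ hB hz (fun y hy => (abs_lt.1 (hinit y hy)).2) t ht x hx⟩

end IsRegularSolution

end Comparison

section Caloric

variable {E : Type*} [NormedAddCommGroup E] [InnerProductSpace ℝ E]

/-- The Gauss kernel of the heat equation, without its normalising factor `(4π)^(-n/2)`. -/
noncomputable def heatKernel (t : ℝ) (x : E) : ℝ :=
  t ^ (-(Module.finrank ℝ E / 2 : ℝ)) * Real.exp (-‖x‖ ^ 2 / (4 * t))

theorem heatKernel_nonneg {t : ℝ} (ht : 0 ≤ t) (x : E) : 0 ≤ heatKernel t x :=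
  mul_nonneg (Real.rpow_nonneg ht _) (Real.exp_pos _).le

theorem heatKernel_le {s t : ℝ} (hs : 0 < s) (hst : s ≤ t) (x : E) :
    heatKernel t x ≤ s ^ (-(Module.finrank ℝ E / 2 : ℝ)) := by
  have hpow := Real.rpow_le_rpow_of_nonpos hs hst
    (neg_nonpos.2 (by positivity : (0 : ℝ) ≤ Module.finrank ℝ E / 2))
  have hexp : Real.exp (-‖x‖ ^ 2 / (4 * t)) ≤ 1 :=
    Real.exp_le_one_iff.2 (div_nonpos_of_nonpos_of_nonneg (by simp) (by linarith))
  calc heatKernel t x ≤ t ^ (-(Module.finrank ℝ E / 2 : ℝ)) * 1 := by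
        unfold heatKernel; gcongr
        exact Real.rpow_nonneg (hs.le.trans hst) _
    _ ≤ _ := by rwa [mul_one]

theorem le_heatKernel_sq {r : ℝ} (hr : 0 < r) {x : E} (hx : ‖x‖ ≤ r) :
    Real.exp (-(1 / 4)) * (r ^ Module.finrank ℝ E)⁻¹ ≤ heatKernel (r ^ 2) x := by
  have hpow : (r ^ 2) ^ (-(Module.finrank ℝ E / 2 : ℝ)) = (r ^ Module.finrank ℝ E)⁻¹ := by
    rw [Real.rpow_neg (by positivity), ← Real.rpow_natCast r 2, ← Real.rpow_mul hr.le]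
    norm_num [mul_div_cancel₀]
  have hexp : Real.exp (-(1 / 4)) ≤ Real.exp (-‖x‖ ^ 2 / (4 * r ^ 2)) := by
    gcongr
    rw [neg_div, neg_le_neg_iff, div_le_div_iff₀ (by positivity) (by norm_num)]
    linarith [pow_le_pow_left₀ (norm_nonneg x) hx 2]
  rw [heatKernel, hpow, mul_comm]
  gcongr

variable [FiniteDimensional ℝ E]

/-- A classical solution of the heat equation on `(0, ∞) × E`, continuous up to time `0`. -/
structure IsCaloric (W : ℝ → E → ℝ) : Prop where
  continuousOn : ContinuousOn (Function.uncurry W) (Ici 0 ×ˢ univ)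
  contDiff : ∀ t > 0, ContDiff ℝ 2 (W t)
  hasDerivAt : ∀ t > 0, ∀ x, HasDerivAt (fun s => W s x) (Δ (W t) x) t

namespace IsCaloric

variable {W W' : ℝ → E → ℝ}

theorem add (hW : IsCaloric W) (hW' : IsCaloric W') : IsCaloric fun t x => W t x + W' t x where
  continuousOn := hW.continuousOn.add hW'.continuousOn
  contDiff t ht := (hW.contDiff t ht).add (hW'.contDiff t ht)
  hasDerivAt t ht x := by
    have hlap : Δ (fun y => W t y + W' t y) x = Δ (W t) x + Δ (W' t) x :=
      (hW.contDiff t ht).contDiffAt.laplacian_add (hW'.contDiff t ht).contDiffAt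
    exact hlap ▸ (hW.hasDerivAt t ht x).add (hW'.hasDerivAt t ht x)

theorem const_mul (hW : IsCaloric W) (c : ℝ) : IsCaloric fun t x => c * W t x where
  continuousOn := hW.continuousOn.const_mul c
  contDiff t ht := contDiff_const.mul (hW.contDiff t ht)
  hasDerivAt t ht x := by
    have hlap : Δ (fun y => c * W t y) x = c * Δ (W t) x :=
      InnerProductSpace.laplacian_smul c (hW.contDiff t ht).contDiffAt
    exact hlap ▸ (hW.hasDerivAt t ht x).const_mul c

theorem const (c : ℝ) : IsCaloric fun _ (_ : E) => c where
  continuousOn := continuousOn_const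
  contDiff _ _ := contDiff_const
  hasDerivAt t _ x := by
    simpa [InnerProductSpace.laplacian_const] using hasDerivAt_const t c

theorem sum {ι : Type*} (s : Finset ι) {W : ι → ℝ → E → ℝ} (hW : ∀ i ∈ s, IsCaloric (W i)) :
    IsCaloric fun t x => ∑ i ∈ s, W i t x := by
  classical
  induction s using Finset.induction_on with
  | empty => simpa using const 0
  | insert i s hi ih =>
    simp only [Finset.sum_insert hi]
    exact (hW i (s.mem_insert_self i)).add (ih fun j hj => hW j (Finset.mem_insert_of_mem hj))

theorem norm_sub_sq (b : E) :
    IsCaloric fun t x => ‖x - b‖ ^ 2 + 2 * Module.finrank ℝ E * t where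
  continuousOn := by unfold Function.uncurry; fun_prop
  contDiff t _ := ((contDiff_id.sub contDiff_const).norm_sq ℝ).add contDiff_const
  hasDerivAt t _ x := by
    have hlap := laplacian_comp_norm_sub_sq (x := x) (b := b)
      (g := fun ρ => ρ + 2 * Module.finrank ℝ E * t) (g' := fun _ => 1)
      (.of_forall fun ρ => (hasDerivAt_id ρ).add_const _) (hasDerivAt_const _ _)
    rw [hlap]
    simpa using ((hasDerivAt_id t).const_mul (2 * Module.finrank ℝ E : ℝ)).const_add (‖x - b‖ ^ 2)

theorem isStrictBarrier (hW : IsCaloric W) {p B C R t₁ : ℝ} {b : E} (hp : 1 < p)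
    (hBC : B ^ (p - 1) < C) (hC : 0 ≤ C)
    (hpos : ∀ t ∈ Icc 0 t₁, ∀ x ∈ closedBall b R, 0 < W t x)
    (hlat : ∀ t ∈ Icc 0 t₁, ∀ x ∈ sphere b R, B < W t x) :
    IsStrictBarrier p (fun _ => B) b R 0 t₁ (fun t x => Real.exp (C * t) * W t x) := by
  have hderiv (t : ℝ) (ht : 0 < t) (x : E) : HasDerivAt (fun s => Real.exp (C * s) * W s x)
      (C * (Real.exp (C * t) * W t x) + Real.exp (C * t) * Δ (W t) x) t := by
    have hexp : HasDerivAt (fun s => Real.exp (C * s)) (Real.exp (C * t) * C) t := by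
      simpa using ((hasDerivAt_id t).const_mul C).exp
    exact (hexp.mul (hW.hasDerivAt t ht x)).congr_deriv (by ring)
  constructor
  · have hexp : ContinuousOn (fun q : ℝ × E => Real.exp (C * q.1))
        (Icc 0 t₁ ×ˢ closedBall b R) := by fun_prop
    exact hexp.mul (hW.continuousOn.mono (prod_mono Icc_subset_Ici_self (subset_univ _)))
  · exact fun t ht x hx => mul_pos (Real.exp_pos _) (hpos t ht x hx)
  · intro t ht x hx
    have hWpos := hpos t ht x (sphere_subset_closedBall hx)
    exact (hlat t ht x hx).trans_le
      (le_mul_of_one_le_left hWpos.le (Real.one_le_exp (mul_nonneg hC ht.1)))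
  · exact fun t ht x _ => (hderiv t ht.1 x).differentiableAt
  · exact fun t ht x _ => contDiffAt_const.mul (hW.contDiff t ht.1).contDiffAt
  · intro t ht x hx hle
    have hzpos : 0 < Real.exp (C * t) * W t x := mul_pos (Real.exp_pos _)
      (hpos t (Ioc_subset_Icc_self ht) x (ball_subset_closedBall hx))
    have hlap : Δ (fun y => Real.exp (C * t) * W t y) x = Real.exp (C * t) * Δ (W t) x :=
      InnerProductSpace.laplacian_smul (Real.exp (C * t)) (hW.contDiff t ht.1).contDiffAt
    have hreaction : (Real.exp (C * t) * W t x) ^ (p - 1) < C :=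
      (Real.rpow_le_rpow hzpos.le hle (by linarith)).trans_lt hBC
    rw [(hderiv t ht.1 x).deriv, hlap]
    linarith [mul_lt_mul_of_pos_right hreaction hzpos]

end IsCaloric

theorem isCaloric_heatKernel {s : ℝ} (hs : 0 < s) (b : E) :
    IsCaloric fun t x => heatKernel (t + s) (x - b) where
  continuousOn := by
    intro q hq
    have hpos : 0 < q.1 + s := add_pos_of_nonneg_of_pos hq.1 hs
    refine ContinuousAt.continuousWithinAt (ContinuousAt.mul ?_ ?_)
    · exact ContinuousAt.rpow_const (by fun_prop) (.inl hpos.ne')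
    · exact (ContinuousAt.div (by fun_prop) (by fun_prop) (by positivity)).rexp
  contDiff t _ := by
    have hnorm : ContDiff ℝ 2 fun x : E => ‖x - b‖ ^ 2 := (contDiff_id.sub contDiff_const).norm_sq ℝ
    exact contDiff_const.mul (hnorm.neg.div_const _).exp
  hasDerivAt t ht x := by
    set τ := t + s
    have hτ : 0 < τ := add_pos ht hs
    have hexp (ρ : ℝ) : HasDerivAt (fun ρ => Real.exp (-ρ / (4 * τ)))
        (-(1 / (4 * τ)) * Real.exp (-ρ / (4 * τ))) ρ := by
      refine ((hasDerivAt_id ρ).neg.div_const (4 * τ)).exp.congr_deriv ?_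
      simp only [Pi.neg_apply, id]
      ring
    have hlap := laplacian_comp_norm_sub_sq (x := x) (b := b)
      (.of_forall fun ρ => (hexp ρ).const_mul (τ ^ (-(Module.finrank ℝ E / 2 : ℝ))))
      (((hexp _).const_mul (-(1 / (4 * τ)))).const_mul (τ ^ (-(Module.finrank ℝ E / 2 : ℝ))))
    have hshift : HasDerivAt (fun t => t + s) 1 t := (hasDerivAt_id t).add_const s
    have hpow := (Real.hasDerivAt_rpow_const (x := τ) (p := -(Module.finrank ℝ E / 2 : ℝ))
      (.inl hτ.ne')).comp t hshift
    have hgauss := ((hasDerivAt_const t (-‖x - b‖ ^ 2)).div (hshift.const_mul 4)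
      (by positivity)).exp
    simp only [heatKernel, hlap]
    refine (hpow.mul hgauss).congr_deriv ?_
    simp only [Function.comp_apply, Pi.div_apply, show t + s = τ from rfl,
      Real.rpow_sub_one hτ.ne']
    field_simp
    ring

end Caloric

section Smoothing

theorem exists_finset_pairwiseDisjoint_ball_cover {X : Type*} [PseudoMetricSpace X] {K : Set X}
    {r : ℝ} (hK : IsCompact K) (hr : 0 < r) :
    ∃ s : Finset X, ↑s ⊆ K ∧ (s : Set X).PairwiseDisjoint (ball · r) ∧
      ∀ x ∈ K, ∃ y ∈ s, dist x y ≤ 2 * r := by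
  lift r to NNReal using hr.le
  obtain ⟨N, -, hNfin, hN⟩ := exists_finite_isCover_of_isCompact
    (ε := r) (NNReal.coe_pos.1 hr).ne' hK
  have hpack : packingNumber (2 * r) K ≠ ⊤ := ne_top_of_le_ne_top hNfin.encard_lt_top.ne
    ((packingNumber_two_mul_le_externalCoveringNumber r K).trans
      hN.externalCoveringNumber_le_encard)
  have hfin : (maximalSeparatedSet (2 * r) K).Finite :=
    Set.encard_ne_top_iff.1 (encard_maximalSeparatedSet hpack ▸ hpack)
  refine ⟨hfin.toFinset, by simpa using maximalSeparatedSet_subset, ?_, fun x hx => ?_⟩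
  · rw [hfin.coe_toFinset]
    intro x hx y hy hxy
    have hsep : 2 * r < edist x y := isSeparated_maximalSeparatedSet hx hy hxy
    refine ball_disjoint_ball ?_
    rw [edist_nndist] at hsep
    have := NNReal.coe_lt_coe.2 (ENNReal.coe_lt_coe.1 (by exact_mod_cast hsep))
    push_cast at this
    linarith
  · obtain ⟨y, hy, hxy⟩ := isCover_maximalSeparatedSet hpack hx
    refine ⟨y, hfin.mem_toFinset.2 hy, ?_⟩
    have hle : edist x y ≤ ((2 * r : NNReal) : ℝ≥0∞) := hxy
    rw [edist_nndist, ENNReal.coe_le_coe] at hle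
    exact_mod_cast hle

variable {E : Type*} [NormedAddCommGroup E] [InnerProductSpace ℝ E] [FiniteDimensional ℝ E]
  [MeasurableSpace E]

/-- A constant `c` such that a mass `m` placed at `y` gives rise to a heat kernel which on
`closedBall y (2r)` at time `(2r)²` dominates `c` times the mean density of `m` on `ball y r`. -/
noncomputable def gaussMassConst (μ : Measure E) : ℝ :=
  Real.exp (-(1 / 4)) * μ.real (ball 0 1) / 2 ^ Module.finrank ℝ E

variable (μ : Measure E) [μ.IsAddHaarMeasure]

theorem measureReal_unitBall_pos : 0 < μ.real (ball 0 1) :=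
  ENNReal.toReal_pos (measure_ball_pos μ 0 one_pos).ne' measure_ball_lt_top.ne

theorem gaussMassConst_pos : 0 < gaussMassConst μ :=
  div_pos (mul_pos (Real.exp_pos _) (measureReal_unitBall_pos μ)) (by positivity)

theorem le_add_setAverage_ball {F : E → ℝ} {x y : E} {r θ : ℝ} (hr : 0 < r)
    (hF : IntegrableOn F (ball y r) μ) (hosc : ∀ z ∈ ball y r, F x ≤ θ + F z) :
    F x ≤ θ + ⨍ z in ball y r, F z ∂μ := by
  obtain ⟨z, hz, hFz⟩ := exists_le_setAverage (measure_ball_pos μ y hr).ne'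
    measure_ball_lt_top.ne hF
  linarith [hosc z hz]

variable [BorelSpace E]

theorem gaussMassConst_mul_inv_measureReal_ball_le {x y : E} {r : ℝ} (hr : 0 < r)
    (hxy : ‖x - y‖ ≤ 2 * r) :
    gaussMassConst μ * (μ.real (ball y r))⁻¹ ≤ heatKernel ((2 * r) ^ 2) (x - y) := by
  have hball := measureReal_unitBall_pos μ
  have hscale : μ.real (ball y r) = r ^ Module.finrank ℝ E * μ.real (ball 0 1) := by
    rw [measureReal_def, Measure.addHaar_ball_of_pos μ y hr, ENNReal.toReal_mul,
      ENNReal.toReal_ofReal (by positivity), measureReal_def]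
  refine le_trans (le_of_eq ?_) (le_heatKernel_sq (by positivity) hxy)
  rw [hscale, gaussMassConst, mul_pow]
  field_simp

theorem setAverage_ball_le_heatKernel {F : E → ℝ} (hF : ∀ x, 0 ≤ F x) {x y : E} {r : ℝ}
    (hr : 0 < r) (hxy : ‖x - y‖ ≤ 2 * r) :
    ⨍ z in ball y r, F z ∂μ ≤
      (gaussMassConst μ)⁻¹ * (∫ z in ball y r, F z ∂μ) * heatKernel ((2 * r) ^ 2) (x - y) := by
  have hc := gaussMassConst_pos μ
  have hmass : 0 ≤ ∫ z in ball y r, F z ∂μ := integral_nonneg hF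
  calc ⨍ z in ball y r, F z ∂μ
      = (gaussMassConst μ)⁻¹ * (∫ z in ball y r, F z ∂μ) *
          (gaussMassConst μ * (μ.real (ball y r))⁻¹) := by
        rw [setAverage_eq, smul_eq_mul]
        field_simp
    _ ≤ _ := by
        gcongr
        exact gaussMassConst_mul_inv_measureReal_ball_le μ hr hxy

theorem exists_heatKernel_majorant {F : E → ℝ} (hF : Continuous F) (hF₀ : ∀ x, 0 ≤ F x) (b : E)
    (R : ℝ) {θ : ℝ} (hθ : 0 < θ) :
    ∃ r > 0, ∃ (s : Finset E) (m : E → ℝ), (∀ y, 0 ≤ m y) ∧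
      gaussMassConst μ * ∑ y ∈ s, m y ≤ ∫ x in closedBall b (R + 1), F x ∂μ ∧
      ∀ x ∈ closedBall b R, F x ≤ θ + ∑ y ∈ s, m y * heatKernel (r ^ 2) (x - y) := by
  have hint (K : Set E) (hK : IsCompact K) : IntegrableOn F K μ :=
    hF.continuousOn.integrableOn_compact hK
  obtain ⟨d, hd, hFd⟩ := Metric.uniformContinuousOn_iff.1
    ((isCompact_closedBall b (R + 1)).uniformContinuousOn_of_continuous hF.continuousOn) θ hθ
  set r := min (d / 3) 1 / 2 with hrdef
  have hr : 0 < r := by positivity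
  have hr₁ : r ≤ 1 / 2 := by linarith [min_le_right (d / 3) 1]
  have hrd : 6 * r ≤ d := by linarith [min_le_left (d / 3) 1]
  obtain ⟨s, hsub, hdisj, hcover⟩ :=
    exists_finset_pairwiseDisjoint_ball_cover (isCompact_closedBall b R) hr
  have hball (y : E) : IntegrableOn F (ball y r) μ :=
    (hint _ (isCompact_closedBall y r)).mono_set ball_subset_closedBall
  have hc := gaussMassConst_pos μ
  have hmass (y : E) : 0 ≤ (gaussMassConst μ)⁻¹ * ∫ z in ball y r, F z ∂μ :=
    mul_nonneg (inv_nonneg.2 hc.le) (integral_nonneg hF₀)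
  have hsubset (y : E) (hy : y ∈ s) : ball y r ⊆ closedBall b (R + 1) :=
    ball_subset_closedBall.trans
      (closedBall_subset_closedBall' (by linarith [mem_closedBall.1 (hsub hy)]))
  refine ⟨2 * r, by positivity, s, _, hmass, ?_, fun x hx => ?_⟩
  · rw [← Finset.mul_sum, mul_inv_cancel_left₀ hc.ne',
      ← integral_biUnion_finset s (fun _ _ => measurableSet_ball) hdisj fun y _ => hball y]
    exact setIntegral_mono_set (hint _ (isCompact_closedBall b _)) (.of_forall hF₀)
      (LE.le.eventuallyLE (iUnion₂_subset hsubset))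
  · obtain ⟨y, hy, hxy⟩ := hcover x hx
    have hosc (z : E) (hz : z ∈ ball y r) : F x ≤ θ + F z := by
      have := hFd x (closedBall_subset_closedBall (by linarith) hx) z (hsubset y hy hz)
        (by linarith [dist_triangle x y z, mem_ball'.1 hz])
      linarith [le_abs_self (F x - F z), Real.dist_eq (F x) (F z)]
    calc F x ≤ θ + ⨍ z in ball y r, F z ∂μ := le_add_setAverage_ball μ hr (hball y) hosc
      _ ≤ θ + (gaussMassConst μ)⁻¹ * (∫ z in ball y r, F z ∂μ) *
            heatKernel ((2 * r) ^ 2) (x - y) := by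
          gcongr
          exact setAverage_ball_le_heatKernel μ hF₀ hr (dist_eq_norm x y ▸ hxy)
      _ ≤ _ := by
          gcongr
          exact Finset.single_le_sum (f := fun y => (gaussMassConst μ)⁻¹ *
            (∫ z in ball y r, F z ∂μ) * heatKernel ((2 * r) ^ 2) (x - y))
            (fun y _ => mul_nonneg (hmass y) (heatKernel_nonneg (by positivity) _)) hy

theorem exists_caloric_majorant {F : E → ℝ} (hF : Continuous F) (hF₀ : ∀ x, 0 ≤ F x) (b : E)
    {R θ B : ℝ} (hR : 0 < R) (hθ : 0 < θ) (hB : 0 ≤ B) :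
    ∃ W : ℝ → E → ℝ, IsCaloric W ∧ (∀ t ≥ 0, ∀ x, 0 < W t x) ∧
      (∀ t ≥ 0, ∀ x ∈ sphere b R, B < W t x) ∧ (∀ x ∈ closedBall b R, F x < W 0 x) ∧
      ∀ t > 0, W t b ≤ t ^ (-(Module.finrank ℝ E / 2 : ℝ)) *
        ((gaussMassConst μ)⁻¹ * ∫ x in closedBall b (R + 1), F x ∂μ) +
          (θ + B / R ^ 2 * (2 * Module.finrank ℝ E * t)) := by
  obtain ⟨r, hr, s, m, hm, hmass, hFle⟩ := exists_heatKernel_majorant μ hF hF₀ b R (half_pos hθ)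
  have hkernel (t : ℝ) (ht : 0 ≤ t) (x : E) :
      0 ≤ ∑ y ∈ s, m y * heatKernel (t + r ^ 2) (x - y) :=
    Finset.sum_nonneg fun y _ => mul_nonneg (hm y) (heatKernel_nonneg (by positivity) _)
  refine ⟨fun t x => ∑ y ∈ s, m y * heatKernel (t + r ^ 2) (x - y) +
      (θ + B / R ^ 2 * (‖x - b‖ ^ 2 + 2 * Module.finrank ℝ E * t)),
    (IsCaloric.sum s fun y _ => (isCaloric_heatKernel (by positivity) y).const_mul _).add
      ((IsCaloric.const θ).add ((IsCaloric.norm_sub_sq b).const_mul _)),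
    fun t ht x => ?_, fun t ht x hx => ?_, fun x hx => ?_, fun t ht => ?_⟩
  · have := hkernel t ht x
    positivity
  · have hR₂ : B / R ^ 2 * ‖x - b‖ ^ 2 = B := by
      rw [mem_sphere_iff_norm.1 hx, div_mul_cancel₀ _ (by positivity)]
    have : 0 ≤ B / R ^ 2 * (2 * Module.finrank ℝ E * t) := by positivity
    linarith [hkernel t ht x, mul_add (B / R ^ 2) (‖x - b‖ ^ 2) (2 * Module.finrank ℝ E * t)]
  · have : 0 ≤ B / R ^ 2 * (‖x - b‖ ^ 2 + 2 * Module.finrank ℝ E * 0) := by positivity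
    simp only [zero_add]
    linarith [hFle x hx]
  · have hsum : ∑ y ∈ s, m y * heatKernel (t + r ^ 2) (b - y) ≤
        t ^ (-(Module.finrank ℝ E / 2 : ℝ)) * ∑ y ∈ s, m y := by
      rw [Finset.mul_sum]
      refine Finset.sum_le_sum fun y _ => ?_
      rw [mul_comm]
      exact mul_le_mul_of_nonneg_right (heatKernel_le ht (by linarith [sq_nonneg r]) _) (hm y)
    have hle : ∑ y ∈ s, m y ≤ (gaussMassConst μ)⁻¹ * ∫ x in closedBall b (R + 1), F x ∂μ :=
      (le_inv_mul_iff₀ (gaussMassConst_pos μ)).2 hmass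
    simp only [sub_self, norm_zero]
    gcongr
    · exact hsum.trans (by gcongr)
    · simp

theorem exists_one_le_div_sq_mul_le {B D θ : ℝ} (hBD : 0 ≤ B * D) (hθ : 0 < θ) :
    ∃ R ≥ 1, B / R ^ 2 * D ≤ θ := by
  have hR : 1 ≤ 1 + B * D / θ := le_add_of_nonneg_right (by positivity)
  refine ⟨1 + B * D / θ, hR, ?_⟩
  have hle : B * D ≤ (1 + B * D / θ) * θ := by
    rw [← div_le_iff₀ hθ]
    exact le_add_of_nonneg_left zero_le_one
  rw [div_mul_eq_mul_div, div_le_iff₀ (by positivity), mul_comm θ]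
  exact hle.trans (by gcongr; exact le_self_pow₀ hR two_ne_zero)

theorem exists_abs_lt_of_small_mass {p B t₁ δ : ℝ} (hp : 1 < p) (hB : 0 ≤ B) (ht₁ : 0 < t₁)
    (hδ : 0 < δ) :
    ∃ ε > 0, ∃ k > 0, ∀ (T : ℝ) (Ω : Set E) (v : ℝ → E → ℝ), IsRegularSolution p T Ω v → t₁ < T →
      (∀ t ∈ Icc 0 t₁, ∀ x ∈ closure Ω, |v t x| ≤ B) →
      ∀ b ∈ closure Ω, ∫ x in Ω ∩ closedBall b k, |v 0 x| ∂μ < ε → |v t₁ b| < δ := by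
  set C := B ^ (p - 1) + 1
  have hC : 0 ≤ C := by positivity
  set θ := Real.exp (-(C * t₁)) * δ / 3
  have hθ : 0 < θ := by positivity
  set P := t₁ ^ (-(Module.finrank ℝ E / 2 : ℝ)) * (gaussMassConst μ)⁻¹
  have hP : 0 < P := mul_pos (Real.rpow_pos_of_pos ht₁ _) (inv_pos.2 (gaussMassConst_pos μ))
  obtain ⟨R, hR, hRθ⟩ := exists_one_le_div_sq_mul_le (B := B)
    (D := 2 * Module.finrank ℝ E * t₁) (by positivity) hθ
  refine ⟨θ / P, div_pos hθ hP, R + 1, by positivity, fun T Ω v hv hT hvB b hb hmass => ?_⟩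
  have hT₀ : (0 : ℝ) ∈ Ico 0 T := ⟨le_rfl, ht₁.trans hT⟩
  set F : E → ℝ := Ω.indicator fun x => |v 0 x|
  have hFmass : P * ∫ x in closedBall b (R + 1), F x ∂μ < θ := by
    rwa [setIntegral_indicator hv.isOpen.measurableSet, inter_comm, ← lt_div_iff₀' hP]
  obtain ⟨W, hW, hpos, hlat, hinit, hcenter⟩ := exists_caloric_majorant μ
    (hv.continuous_indicator_abs hT₀)
    (fun x => indicator_nonneg (fun x _ => abs_nonneg _) x) b (one_pos.trans_le hR) hθ hB
  have hWθ : W t₁ b < Real.exp (-(C * t₁)) * δ := by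
    have h3 : 3 * θ = Real.exp (-(C * t₁)) * δ := by ring
    linarith [hcenter t₁ ht₁]
  have hbarrier := hW.isStrictBarrier (t₁ := t₁) (b := b) (R := R) hp (lt_add_one _) hC
    (fun t ht x _ => hpos t ht.1 x) (fun t ht x hx => hlat t ht.1 x hx)
  calc |v t₁ b| < Real.exp (C * t₁) * W t₁ b :=
        hv.abs_lt_of_isStrictBarrier le_rfl hT hvB hbarrier
          (fun x hx => by simpa [F, hv.indicator_abs hT₀ hx.2] using hinit x hx.1) t₁
          ⟨ht₁.le, le_rfl⟩ b ⟨mem_closedBall_self (by positivity), hb⟩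
    _ < Real.exp (C * t₁) * (Real.exp (-(C * t₁)) * δ) := by gcongr
    _ = δ := by rw [← mul_assoc, ← Real.exp_add, add_neg_cancel, Real.exp_zero, one_mul]

end Smoothing

section TypeI

theorem rpow_typeI_bound {p M τ : ℝ} (hp : 1 < p) (hM : 0 ≤ M) (hτ : 0 < τ) :
    (M * τ ^ (-(1 / (p - 1)))) ^ (p - 1) = M ^ (p - 1) * τ⁻¹ := by
  have hp' : p - 1 ≠ 0 := (sub_pos.2 hp).ne'
  rw [Real.mul_rpow hM (by positivity), ← Real.rpow_mul hτ.le, neg_mul, one_div_mul_cancel hp',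
    Real.rpow_neg_one]

theorem mul_pow_le_add_half_mul_pow_succ {c Y : ℝ} (hc : 0 ≤ c) (hY : 0 ≤ Y) (n : ℕ) :
    c * Y ^ n ≤ c * (2 * c) ^ n + 1 / 2 * Y ^ (n + 1) := by
  rcases le_total Y (2 * c) with h | h
  · have : c * Y ^ n ≤ c * (2 * c) ^ n := by gcongr
    have : 0 ≤ Y ^ (n + 1) := by positivity
    linarith
  · have : 2 * c * Y ^ n ≤ Y ^ (n + 1) := by
      rw [pow_succ']
      gcongr
    have : 0 ≤ c * (2 * c) ^ n := by positivity
    linarith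

theorem rpow_mul_lt_of_le_typeI_bound {p M δ τ g S K : ℝ} (hp : 1 < p) (hM : 0 ≤ M) (hδ : 0 < δ)
    (hδ' : (3 * δ) ^ (p - 1) * 3 < 1) (hK : 6 * M ^ (p - 1) ≤ K) (hτ : 0 < τ)
    (hg : 0 ≤ g) (hg' : g ≤ 2) (hS : 0 ≤ S)
    (hz : δ * (g + τ * S) ≤ M * τ ^ (-(1 / (p - 1)))) :
    (δ * (g + τ * S)) ^ (p - 1) * (δ * (g + τ * S)) < δ * (1 + K / 2 * S) := by
  have : 0 ≤ p - 1 := by linarith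
  have hK₀ : 0 ≤ K := le_trans (by positivity) hK
  set z := δ * (g + τ * S) with hzdef
  have : 0 ≤ z := by positivity
  -- For `τ * S ≤ 1` the smallness of `δ` suffices; otherwise `z` is comparable to `δ * τ * S`, and
  -- the type I bound turns the factor `z ^ (p - 1)` into `τ⁻¹`.
  rcases le_total (τ * S) 1 with h | h
  · have hz3 : z ≤ 3 * δ := by
      rw [hzdef, mul_comm]
      gcongr
      linarith
    calc z ^ (p - 1) * z ≤ (3 * δ) ^ (p - 1) * (3 * δ) := by gcongr
      _ = (3 * δ) ^ (p - 1) * 3 * δ := by ring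
      _ < 1 * δ := by gcongr
      _ ≤ δ * (1 + K / 2 * S) := by
        rw [mul_comm]
        gcongr
        exact le_add_of_nonneg_right (by positivity)
  · have hz3 : z ≤ δ * (3 * (τ * S)) := by
      rw [hzdef]
      gcongr
      linarith
    have hzp : z ^ (p - 1) ≤ M ^ (p - 1) * τ⁻¹ := by
      rw [← rpow_typeI_bound hp hM hτ]
      gcongr
    calc z ^ (p - 1) * z ≤ (M ^ (p - 1) * τ⁻¹) * (δ * (3 * (τ * S))) := by gcongr
      _ = δ * (6 * M ^ (p - 1) / 2 * S) := by
        field_simp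
        ring
      _ ≤ δ * (K / 2 * S) := by gcongr
      _ < δ * (1 + K / 2 * S) := by
        gcongr
        exact lt_one_add _

theorem exists_pos_rpow_mul_lt_one {q : ℝ} (hq : 0 < q) : ∃ δ > 0, (3 * δ) ^ q * 3 < (1 : ℝ) := by
  have hcont : ContinuousAt (fun δ : ℝ => (3 * δ) ^ q * 3) 0 :=
    .mul (.rpow_const (by fun_prop) (.inr hq.le)) (by fun_prop)
  have hev : ∀ᶠ δ in 𝓝 (0 : ℝ), (3 * δ) ^ q * 3 < 1 :=
    hcont.eventually (gt_mem_nhds (by simp [Real.zero_rpow hq.ne']))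
  obtain ⟨δ, hlt, hδ⟩ := ((hev.filter_mono nhdsWithin_le_nhds).and
    (self_mem_nhdsWithin (s := Ioi (0 : ℝ)))).exists
  exact ⟨δ, hδ, hlt⟩

variable {E : Type*} [NormedAddCommGroup E]

/-- The Laplacian of `‖x‖^(2(n+2))` in dimension `d` is `laplacianPowConst n d * ‖x‖^(2(n+1))`. -/
def laplacianPowConst (n d : ℕ) : ℝ :=
  4 * (n + 2) * (n + 1) + 2 * (n + 2) * d

theorem laplacianPowConst_nonneg (n d : ℕ) : 0 ≤ laplacianPowConst n d := by
  unfold laplacianPowConst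
  positivity

/-- The barrier which confines a solution satisfying a type I estimate with blow-up time `1` near
`b` after time `t₀`. The last term is `(1 - t) * Y ^ (n + 2)` in terms of the self-similar variable
`Y = ‖x - b‖² / (1 - t)`; for large `n` it exceeds the type I bound at distance `1` from `b`. -/
noncomputable def polynomialBarrier (n : ℕ) (δ C t₀ : ℝ) (b : E) (t : ℝ) (x : E) : ℝ :=
  δ * (1 + C * (t - t₀) + (1 - t)⁻¹ ^ (n + 1) * (‖x - b‖ ^ 2) ^ (n + 2))

section polynomialBarrier

variable {n : ℕ} {δ C t₀ t : ℝ} {b : E}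

theorem polynomialBarrier_eq (ht : t < 1) (x : E) :
    polynomialBarrier n δ C t₀ b t x =
      δ * (1 + C * (t - t₀) + (1 - t) * ((1 - t)⁻¹ * ‖x - b‖ ^ 2) ^ (n + 2)) := by
  have : 1 - t ≠ 0 := (sub_pos.2 ht).ne'
  rw [polynomialBarrier, mul_pow, ← mul_assoc (1 - t), pow_succ' (1 - t)⁻¹ (n + 1),
    mul_inv_cancel_left₀ this]

theorem le_polynomialBarrier (hδ : 0 ≤ δ) (hC : 0 ≤ C) (ht₀ : t₀ ≤ t) (ht : t < 1) (x : E) :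
    δ ≤ polynomialBarrier n δ C t₀ b t x := by
  have : 0 ≤ 1 - t := sub_nonneg.2 ht.le
  have : 0 ≤ t - t₀ := sub_nonneg.2 ht₀
  refine le_mul_of_one_le_right hδ ?_
  rw [add_assoc]
  exact le_add_of_nonneg_right (by positivity)

theorem continuousOn_polynomialBarrier :
    ContinuousOn (Function.uncurry (polynomialBarrier n δ C t₀ b)) (Iio 1 ×ˢ univ) := by
  refine continuousOn_const.mul (.add (by fun_prop) (.mul (.pow (.inv₀ (by fun_prop) ?_) _)
    (by fun_prop)))
  exact fun z hz => (sub_pos.2 hz.1).ne'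

theorem hasDerivAt_polynomialBarrier_time (ht : t < 1) (x : E) :
    HasDerivAt (fun s => polynomialBarrier n δ C t₀ b s x)
      (δ * (C + (n + 1) * ((1 - t)⁻¹ * ‖x - b‖ ^ 2) ^ (n + 2))) t := by
  have hinv : HasDerivAt (fun s : ℝ => (1 - s)⁻¹) ((1 - t)⁻¹ ^ 2) t :=
    (((hasDerivAt_id t).const_sub 1).inv (sub_pos.2 ht).ne').congr_deriv (by simp)
  have hlin : HasDerivAt (fun s : ℝ => 1 + C * (s - t₀)) (C * 1) t :=
    (((hasDerivAt_id t).sub_const t₀).const_mul C).const_add 1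
  refine ((hlin.add ((hinv.pow (n + 1)).mul_const ((‖x - b‖ ^ 2) ^ (n + 2)))).const_mul
    δ).congr_deriv ?_
  rw [mul_pow]
  push_cast
  ring_nf

theorem typeI_bound_lt_polynomialBarrier {p M : ℝ} (hn : 1 / (p - 1) ≤ n) (hM : 0 ≤ M)
    (hδ : 0 < δ) (hC : 0 ≤ C) (ht₀ : 0 ≤ t₀) (hMδ : M * (1 - t₀) ≤ δ) (ht : t ∈ Ico t₀ 1) {x : E}
    (hx : ‖x - b‖ = 1) :
    M * (1 - t) ^ (-(1 / (p - 1))) < polynomialBarrier n δ C t₀ b t x := by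
  have hτ : 0 < 1 - t := sub_pos.2 ht.2
  have hrpow : (1 - t) ^ (-(1 / (p - 1))) ≤ (1 - t)⁻¹ ^ n := by
    rw [inv_pow, ← Real.rpow_natCast, ← Real.rpow_neg hτ.le]
    exact Real.rpow_le_rpow_of_exponent_ge hτ (by linarith [ht.1]) (neg_le_neg hn)
  have hMτ : M ≤ δ * (1 - t)⁻¹ := by
    rw [← div_eq_mul_inv, le_div_iff₀ hτ]
    exact le_trans (by gcongr; exact ht.1) hMδ
  have : 0 ≤ t - t₀ := sub_nonneg.2 ht.1
  calc M * (1 - t) ^ (-(1 / (p - 1))) ≤ (δ * (1 - t)⁻¹) * (1 - t)⁻¹ ^ n := by gcongr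
    _ = δ * (1 - t)⁻¹ ^ (n + 1) := by ring
    _ < δ * (1 + C * (t - t₀) + (1 - t)⁻¹ ^ (n + 1)) := by
      gcongr
      exact lt_add_of_pos_left _ (by positivity)
    _ = polynomialBarrier n δ C t₀ b t x := by simp [polynomialBarrier, hx]

variable [InnerProductSpace ℝ E]

theorem contDiff_polynomialBarrier : ContDiff ℝ 2 (polynomialBarrier n δ C t₀ b t) := by
  unfold polynomialBarrier
  exact contDiff_const.mul (contDiff_const.add (contDiff_const.mul
    (((contDiff_id.sub contDiff_const).norm_sq ℝ).pow _)))

variable [FiniteDimensional ℝ E]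

theorem laplacian_polynomialBarrier (x : E) :
    Δ (polynomialBarrier n δ C t₀ b t) x = δ * (laplacianPowConst n (Module.finrank ℝ E) *
      ((1 - t)⁻¹ * ‖x - b‖ ^ 2) ^ (n + 1)) := by
  set τ' := (1 - t)⁻¹ ^ (n + 1) with hτ'
  have hg (ρ : ℝ) : HasDerivAt (fun ρ => δ * (1 + C * (t - t₀) + τ' * ρ ^ (n + 2)))
      (δ * (τ' * ((n + 2) * ρ ^ (n + 1)))) ρ := by
    refine ((((hasDerivAt_pow (n + 2) ρ).const_mul τ').const_add _).const_mul δ).congr_deriv ?_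
    push_cast
    rfl
  have hg' (ρ : ℝ) : HasDerivAt (fun ρ => δ * (τ' * ((n + 2) * ρ ^ (n + 1))))
      (δ * (τ' * ((n + 2) * ((n + 1) * ρ ^ n)))) ρ := by
    refine ((((hasDerivAt_pow (n + 1) ρ).const_mul _).const_mul τ').const_mul δ).congr_deriv ?_
    push_cast
    rfl
  refine (laplacian_comp_norm_sub_sq (b := b) (.of_forall hg) (hg' (‖x - b‖ ^ 2))).trans ?_
  rw [mul_pow, ← hτ', laplacianPowConst]
  ring

theorem isStrictBarrier_polynomialBarrier {p M t₁ : ℝ} (hp : 1 < p) (hM : 0 ≤ M)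
    (hn : 6 * M ^ (p - 1) ≤ n + 1) (hn' : 1 / (p - 1) ≤ n) (hδ : 0 < δ)
    (hδ' : (3 * δ) ^ (p - 1) * 3 < 1) {c : ℝ} (hc : laplacianPowConst n (Module.finrank ℝ E) = c)
    (hC : C = 1 + c * (2 * c) ^ (n + 1)) (ht₀ : 0 ≤ t₀) (hMδ : M * (1 - t₀) ≤ δ)
    (hCt₀ : C * (1 - t₀) ≤ 1) (ht₁ : t₁ < 1) :
    IsStrictBarrier p (fun t => M * (1 - t) ^ (-(1 / (p - 1)))) b 1 t₀ t₁
      (polynomialBarrier n δ C t₀ b) := by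
  have hc₀ : 0 ≤ c := hc ▸ laplacianPowConst_nonneg n _
  have hC₀ : 0 ≤ C := by rw [hC]; positivity
  refine
  { continuousOn := continuousOn_polynomialBarrier.mono
      (prod_mono (fun t ht => ht.2.trans_lt ht₁) (subset_univ _))
    pos := fun t ht x _ =>
      hδ.trans_le (le_polynomialBarrier hδ.le hC₀ ht.1 (ht.2.trans_lt ht₁) x)
    lateral := fun t ht x hx => typeI_bound_lt_polynomialBarrier hn' hM hδ hC₀ ht₀ hMδ
      ⟨ht.1, ht.2.trans_lt ht₁⟩ (mem_sphere_iff_norm.1 hx)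
    differentiableAt_time := fun t ht x _ =>
      (hasDerivAt_polynomialBarrier_time (ht.2.trans_lt ht₁) x).differentiableAt
    contDiffAt_space := fun t _ x _ => contDiff_polynomialBarrier.contDiffAt
    supersolution := fun t ht x _ hz => ?_ }
  have ht1 : t < 1 := ht.2.trans_lt ht₁
  have hτ : 0 < 1 - t := sub_pos.2 ht1
  have hY : 0 ≤ (1 - t)⁻¹ * ‖x - b‖ ^ 2 := by positivity
  have hCt : 0 ≤ C * (t - t₀) := mul_nonneg hC₀ (sub_nonneg.2 ht.1.le)
  have hCt' : C * (t - t₀) ≤ 1 := le_trans (by gcongr) hCt₀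
  rw [laplacian_polynomialBarrier, (hasDerivAt_polynomialBarrier_time ht1 x).deriv, hc]
  rw [polynomialBarrier_eq ht1] at hz ⊢
  set Y := (1 - t)⁻¹ * ‖x - b‖ ^ 2
  have hreaction := rpow_mul_lt_of_le_typeI_bound hp hM hδ hδ' hn hτ (by linarith) (by linarith)
    (pow_nonneg hY (n + 2)) hz
  have hdiffusion := mul_pow_le_add_half_mul_pow_succ hc₀ hY (n + 1)
  have hn₀ : 0 ≤ (n : ℝ) * Y ^ (n + 2) := by positivity
  have hsum : c * Y ^ (n + 1) + (1 + (n + 1) / 2 * Y ^ (n + 2)) ≤ C + (n + 1) * Y ^ (n + 2) := by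
    linarith
  refine (add_lt_add_right hreaction _).trans_le ?_
  rw [← mul_add]
  exact mul_le_mul_of_nonneg_left hsum hδ.le

end polynomialBarrier

theorem exists_abs_le_of_abs_lt_ball [InnerProductSpace ℝ E] [FiniteDimensional ℝ E]
    {p M : ℝ} (hp : 1 < p) (hM : 0 ≤ M) :
    ∃ δ > 0, ∃ t₀ ∈ Ioo (0 : ℝ) 1, ∀ (Ω : Set E) (v : ℝ → E → ℝ), IsRegularSolution p 1 Ω v →
      (∀ t ∈ Ico 0 1, ∀ x ∈ closure Ω, |v t x| ≤ M * (1 - t) ^ (-(1 / (p - 1)))) →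
      ∀ b ∈ closure Ω, (∀ x ∈ closedBall b 1 ∩ closure Ω, |v t₀ x| < δ) →
        ∀ t ∈ Ico t₀ 1, |v t b| ≤ 2 * δ := by
  obtain ⟨n, hn⟩ := exists_nat_ge (max (6 * M ^ (p - 1)) (1 / (p - 1)))
  obtain ⟨hn, hn'⟩ := max_le_iff.1 hn
  obtain ⟨δ, hδ, hδ'⟩ := exists_pos_rpow_mul_lt_one (sub_pos.2 hp)
  set c := laplacianPowConst n (Module.finrank ℝ E) with hc
  have hc₀ : 0 ≤ c := laplacianPowConst_nonneg _ _
  set C := 1 + c * (2 * c) ^ (n + 1) with hC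
  have hC₀ : 0 ≤ C := by positivity
  obtain ⟨t₀, ht₀, hCt₀, hMt₀⟩ : ∃ t₀ ∈ Ioo (0 : ℝ) 1, C * (1 - t₀) ≤ 1 ∧ M * (1 - t₀) ≤ δ := by
    have hlim (K : ℝ) : Tendsto (fun t => K * (1 - t)) (𝓝[<] (1 : ℝ)) (𝓝 0) :=
      ((by fun_prop : Continuous fun t : ℝ => K * (1 - t)).tendsto' 1 0 (by simp)).mono_left
        nhdsWithin_le_nhds
    exact ((eventually_mem_set.2 (Ioo_mem_nhdsLT one_pos)).and
      (((hlim C).eventually_le_const one_pos).and ((hlim M).eventually_le_const hδ))).exists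
  refine ⟨δ, hδ, t₀, ht₀, fun Ω v hv hvM b hb hsmall t ht => ?_⟩
  have hbarrier := isStrictBarrier_polynomialBarrier (b := b) hp hM (by linarith) hn' hδ hδ' hc.symm
    hC ht₀.1.le hMt₀ hCt₀ ht.2
  have hlt := hv.abs_lt_of_isStrictBarrier ht₀.1.le ht.2
    (fun s hs => hvM s ⟨ht₀.1.le.trans hs.1, hs.2.trans_lt ht.2⟩) hbarrier
    (fun x hx => (hsmall x hx).trans_le (le_polynomialBarrier hδ.le hC₀ le_rfl ht₀.2 x))
    t ⟨ht.1, le_rfl⟩ b ⟨mem_closedBall_self zero_le_one, hb⟩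
  have hCt : C * (t - t₀) ≤ 1 := le_trans (by gcongr; exact ht.2.le) hCt₀
  calc |v t b| ≤ polynomialBarrier n δ C t₀ b t b := hlt.le
    _ = δ * (1 + C * (t - t₀)) := by simp [polynomialBarrier]
    _ ≤ 2 * δ := by nlinarith

end TypeI

section Rescaling

variable {E : Type*} [NormedAddCommGroup E] [InnerProductSpace ℝ E]
  {p M T : ℝ} {Ω : Set E} {v : ℝ → E → ℝ} {a : E}

/-- The image of `v` under the scaling of `v_t = Δv + |v|^(p-1) v` about `(0, a)` which maps the
time interval `[0, T)` to `[0, 1)`. -/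
noncomputable def parabolicRescaling (p T : ℝ) (a : E) (v : ℝ → E → ℝ) (s : ℝ) (y : E) : ℝ :=
  T ^ (1 / (p - 1)) * v (T * s) (a + √T • y)

theorem abs_parabolicRescaling (hT : 0 < T) (s : ℝ) (y : E) :
    |parabolicRescaling p T a v s y| = T ^ (1 / (p - 1)) * |v (T * s) (a + √T • y)| := by
  rw [parabolicRescaling, abs_mul, abs_of_pos (by positivity)]

theorem abs_parabolicRescaling_le (hT : 0 < T) {s : ℝ} (hs : s < 1) {y : E}
    (hv : |v (T * s) (a + √T • y)| ≤ M * (T - T * s) ^ (-(1 / (p - 1)))) :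
    |parabolicRescaling p T a v s y| ≤ M * (1 - s) ^ (-(1 / (p - 1))) := by
  rw [← mul_one_sub, Real.mul_rpow hT.le (sub_nonneg.2 hs.le)] at hv
  rw [abs_parabolicRescaling hT]
  calc _ ≤ T ^ (1 / (p - 1)) * (M * (T ^ (-(1 / (p - 1))) * (1 - s) ^ (-(1 / (p - 1))))) := by
        gcongr
    _ = M * (1 - s) ^ (-(1 / (p - 1))) := by
        rw [Real.rpow_neg hT.le]
        field_simp

theorem closure_preimage_affine {r : ℝ} (hr : r ≠ 0) :
    closure ((fun y => a + r • y) ⁻¹' Ω) = (fun y => a + r • y) ⁻¹' closure Ω :=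
  (((Homeomorph.smulOfNeZero r hr).trans (Homeomorph.addLeft a)).preimage_closure Ω).symm

theorem frontier_preimage_affine {r : ℝ} (hr : r ≠ 0) :
    frontier ((fun y => a + r • y) ⁻¹' Ω) = (fun y => a + r • y) ⁻¹' frontier Ω :=
  (((Homeomorph.smulOfNeZero r hr).trans (Homeomorph.addLeft a)).preimage_frontier Ω).symm

theorem preimage_affine_closedBall {r k : ℝ} (hr : 0 < r) :
    (fun y => a + r • y) ⁻¹' closedBall a (k * r) = closedBall 0 k := by
  ext y
  rw [mem_preimage, mem_closedBall, dist_self_add_left, norm_smul, Real.norm_of_nonneg hr.le,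
    mul_comm, mul_le_mul_iff_left₀ hr, mem_closedBall_zero_iff]

variable [FiniteDimensional ℝ E]

theorem IsRegularSolution.rescale (hp : 1 < p) (hT : 0 < T)
    (hv : IsRegularSolution p T Ω v) (a : E) :
    IsRegularSolution p 1 ((fun y => a + √T • y) ⁻¹' Ω) (parabolicRescaling p T a v) := by
  have hr : √T ≠ 0 := (Real.sqrt_pos.2 hT).ne'
  have hIco (s : ℝ) (hs : s ∈ Ico (0 : ℝ) 1) : T * s ∈ Ico 0 T :=
    ⟨mul_nonneg hT.le hs.1, mul_lt_of_lt_one_right hT hs.2⟩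
  have hIoo (s : ℝ) (hs : s ∈ Ioo (0 : ℝ) 1) : T * s ∈ Ioo 0 T :=
    ⟨mul_pos hT hs.1, mul_lt_of_lt_one_right hT hs.2⟩
  have hderiv (s : ℝ) (hs : s ∈ Ioo (0 : ℝ) 1) (y : E) (hy : a + √T • y ∈ Ω) :
      HasDerivAt (fun s => parabolicRescaling p T a v s y)
        (T ^ (1 / (p - 1)) * (deriv (fun t => v t (a + √T • y)) (T * s) * (T * 1))) s :=
    ((hv.differentiableAt_time _ (hIoo s hs) _ hy).hasDerivAt.comp s
      ((hasDerivAt_id s).const_mul T)).const_mul _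
  have hspace (s : ℝ) (hs : s ∈ Ioo (0 : ℝ) 1) (y : E) (hy : a + √T • y ∈ Ω) :
      ContDiffAt ℝ 2 (fun y => v (T * s) (a + √T • y)) y :=
    (hv.contDiffAt_space _ (hIoo s hs) _ hy).comp y (f := fun y => a + √T • y) (by fun_prop)
  refine
  { isOpen := hv.isOpen.preimage (by fun_prop)
    continuousOn := ?_
    boundary := fun s hs y hy => ?_
    differentiableAt_time := fun s hs y hy => (hderiv s hs y hy).differentiableAt
    contDiffAt_space := fun s hs y hy => contDiffAt_const.mul (hspace s hs y hy)
    equation := fun s hs y hy => ?_ }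
  · rw [closure_preimage_affine hr]
    exact continuousOn_const.mul (hv.continuousOn.comp
      (f := fun z : ℝ × E => (T * z.1, a + √T • z.2)) (by fun_prop)
      fun z hz => ⟨hIco z.1 hz.1, hz.2⟩)
  · rw [frontier_preimage_affine hr] at hy
    exact mul_eq_zero_of_right _ (hv.boundary _ (hIco s hs) _ hy)
  · have hscale : (T ^ (1 / (p - 1))) ^ (p - 1) = T := by
      rw [← Real.rpow_mul hT.le, one_div_mul_cancel (sub_pos.2 hp).ne', Real.rpow_one]
    have hlap : Δ (parabolicRescaling p T a v s) y =
        T ^ (1 / (p - 1)) * (T * Δ (v (T * s)) (a + √T • y)) := by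
      have := InnerProductSpace.laplacian_smul (T ^ (1 / (p - 1))) (hspace s hs y hy)
      rw [laplacian_comp_affine, Real.sq_sqrt hT.le] at this
      exact this
    rw [(hderiv s hs y hy).deriv, hlap, hv.equation _ (hIoo s hs) _ hy, abs_parabolicRescaling hT,
      Real.mul_rpow (by positivity) (abs_nonneg _), hscale, parabolicRescaling]
    ring

variable [MeasurableSpace E] [BorelSpace E] (μ : Measure E) [μ.IsAddHaarMeasure]

theorem setIntegral_preimage_affine {S : Set E} (hS : MeasurableSet S) (f : E → ℝ) (a : E) {r : ℝ}
    (hr : 0 < r) :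
    ∫ y in (fun y => a + r • y) ⁻¹' S, f (a + r • y) ∂μ =
      (r ^ Module.finrank ℝ E)⁻¹ * ∫ x in S, f x ∂μ := by
  rw [← integral_indicator (hS.preimage (by fun_prop)), ← integral_indicator hS,
    ← integral_add_left_eq_self (S.indicator f) a, ← smul_eq_mul,
    ← Measure.integral_comp_smul_of_nonneg μ (fun y => S.indicator f (a + y)) r (hR := hr.le)]
  rfl

end Rescaling

section Regularity

variable {E : Type*} [NormedAddCommGroup E] [InnerProductSpace ℝ E] [FiniteDimensional ℝ E]
  [MeasurableSpace E] [BorelSpace E]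

theorem IsRegularSolution.integrableOn_abs (μ : Measure E) [IsLocallyFiniteMeasure μ]
    {p T t : ℝ} {Ω K : Set E} {v : ℝ → E → ℝ}
    (hv : IsRegularSolution p T Ω v) (ht : t ∈ Ico 0 T) (hK : IsCompact K) :
    IntegrableOn (fun x => |v t x|) (Ω ∩ K) μ :=
  (((hv.continuousOn_space ht).abs.mono inter_subset_left).integrableOn_compact
    (hK.inter_left isClosed_closure)).mono_set (inter_subset_inter_left _ subset_closure)

variable (μ : Measure E) [μ.IsAddHaarMeasure]

theorem exists_abs_le_of_small_mass_unit {p M : ℝ} (hp : 1 < p) (hM : 0 ≤ M) :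
    ∃ ε > 0, ∃ k > 0, ∃ t₀ < 1, ∃ B, ∀ (Ω : Set E) (v : ℝ → E → ℝ), IsRegularSolution p 1 Ω v →
      (∀ t ∈ Ico 0 1, ∀ x ∈ closure Ω, |v t x| ≤ M * (1 - t) ^ (-(1 / (p - 1)))) →
      ∫ x in Ω ∩ closedBall 0 k, |v 0 x| ∂μ < ε →
        ∀ t ∈ Ico t₀ 1, ∀ x ∈ Ω ∩ ball 0 1, |v t x| ≤ B := by
  obtain ⟨δ, hδ, t₀, ht₀, hpersist⟩ := exists_abs_le_of_abs_lt_ball (E := E) hp hM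
  have hτ₀ : 0 < 1 - t₀ := sub_pos.2 ht₀.2
  obtain ⟨ε, hε, k, hk, hsmooth⟩ := exists_abs_lt_of_small_mass μ
    (B := M * (1 - t₀) ^ (-(1 / (p - 1)))) hp (by positivity) ht₀.1 hδ
  refine ⟨ε, hε, k + 2, by positivity, t₀, ht₀.2, 2 * δ, fun Ω v hv hvM hmass t ht x hx =>
    hpersist Ω v hv hvM x (subset_closure hx.1) (fun y hy => ?_) t ht⟩
  refine hsmooth 1 Ω v hv ht₀.2 (fun s hs z hz => ?_) y hy.2 (lt_of_le_of_lt ?_ hmass)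
  · refine (hvM s ⟨hs.1, hs.2.trans_lt ht₀.2⟩ z hz).trans ?_
    gcongr M * ?_
    exact Real.rpow_le_rpow_of_nonpos hτ₀ (by linarith [hs.2])
      (neg_nonpos.2 (one_div_nonneg.2 (sub_nonneg.2 hp.le)))
  · refine setIntegral_mono_set
      (hv.integrableOn_abs μ ⟨le_rfl, one_pos⟩ (isCompact_closedBall _ _))
      (.of_forall fun _ => abs_nonneg _) (LE.le.eventuallyLE (inter_subset_inter_right _
        (closedBall_subset_closedBall' ?_)))
    linarith [dist_triangle y x 0, mem_closedBall.1 hy.1, mem_ball.1 hx.2]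

theorem exists_abs_le_of_small_mass {p M : ℝ} (hp : 1 < p) (hM : 0 ≤ M) :
    ∃ ε > 0, ∃ k > 0, ∀ (T : ℝ) (Ω : Set E) (v : ℝ → E → ℝ), 0 < T → IsRegularSolution p T Ω v →
      (∀ t ∈ Ico 0 T, ∀ x ∈ closure Ω, |v t x| ≤ M * (T - t) ^ (-(1 / (p - 1)))) →
      ∀ a : E, ∫ x in Ω ∩ closedBall a (k * √T), |v 0 x| ∂μ <
          ε * (T ^ (-(1 / (p - 1))) * √T ^ Module.finrank ℝ E) →
        ∃ t₀ < T, ∃ r > 0, ∃ B, ∀ t ∈ Ico t₀ T, ∀ x ∈ Ω ∩ ball a r, |v t x| ≤ B := by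
  obtain ⟨ε, hε, k, hk, t₀, ht₀, B, hunit⟩ := exists_abs_le_of_small_mass_unit (E := E) μ hp hM
  refine ⟨ε, hε, k, hk, fun T Ω v hT hv hvM a hmass => ?_⟩
  have hr : 0 < √T := Real.sqrt_pos.2 hT
  have hβ : 0 < T ^ (1 / (p - 1)) := by positivity
  have hbound := hunit _ _ (hv.rescale hp hT a) (fun s hs y hy => ?typeI) ?mass
  case typeI =>
    rw [closure_preimage_affine hr.ne'] at hy
    exact abs_parabolicRescaling_le hT hs.2
      (hvM _ ⟨mul_nonneg hT.le hs.1, mul_lt_of_lt_one_right hT hs.2⟩ _ hy)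
  case mass =>
    simp only [abs_parabolicRescaling hT, mul_zero]
    rw [← preimage_affine_closedBall (a := a) hr, ← preimage_inter, integral_const_mul,
      setIntegral_preimage_affine μ (hv.isOpen.measurableSet.inter measurableSet_closedBall)
        (fun x => |v 0 x|) a hr]
    calc _ < T ^ (1 / (p - 1)) * ((√T ^ Module.finrank ℝ E)⁻¹ *
          (ε * (T ^ (-(1 / (p - 1))) * √T ^ Module.finrank ℝ E))) := by gcongr
      _ = ε := by
        rw [Real.rpow_neg hT.le]
        field_simp
  refine ⟨T * t₀, mul_lt_of_lt_one_right hT ht₀, √T, hr, B / T ^ (1 / (p - 1)),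
    fun t ht x hx => ?_⟩
  have hxy : a + √T • ((√T)⁻¹ • (x - a)) = x := by rw [smul_inv_smul₀ hr.ne', add_sub_cancel]
  have h := hbound (t / T) ⟨(le_div_iff₀' hT).2 ht.1, (div_lt_one hT).2 ht.2⟩ ((√T)⁻¹ • (x - a))
    ⟨by rw [mem_preimage, hxy]; exact hx.1, ?_⟩
  · rw [abs_parabolicRescaling hT, mul_div_cancel₀ _ hT.ne', hxy] at h
    exact (le_div_iff₀' hβ).2 h
  · rw [mem_ball_zero_iff, norm_smul, norm_inv, Real.norm_of_nonneg hr.le, inv_mul_lt_iff₀ hr,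
      mul_one]
    exact mem_ball_iff_norm.1 hx.2

end Regularity

section Integral

theorem le_add_max_mul_rpow {y B l : ℝ} (q : ℝ) (hy : 0 ≤ y) (hyB : y ≤ B) (hl : 0 < l) :
    y ≤ l + max (l ^ (1 - q)) (B ^ (1 - q)) * y ^ q := by
  have : 0 ≤ B := hy.trans hyB
  rcases le_or_gt y l with hyl | hly
  · exact hyl.trans (le_add_of_nonneg_right (by positivity))
  · have hy₀ : 0 < y := hl.trans hly
    have hmax : y ^ (1 - q) ≤ max (l ^ (1 - q)) (B ^ (1 - q)) := by
      rcases le_total q 1 with hq | hq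
      · exact le_max_of_le_right (Real.rpow_le_rpow hy hyB (sub_nonneg.2 hq))
      · exact le_max_of_le_left (Real.rpow_le_rpow_of_nonpos hl hly.le (sub_nonpos.2 hq))
    calc y = y ^ (1 - q) * y ^ q := by rw [← Real.rpow_add hy₀, sub_add_cancel, Real.rpow_one]
      _ ≤ max (l ^ (1 - q)) (B ^ (1 - q)) * y ^ q := by gcongr
      _ ≤ _ := le_add_of_nonneg_left hl.le

variable {α : Type*} [MeasurableSpace α] {μ : Measure α} [IsFiniteMeasure μ] {f : α → ℝ} {q : ℝ}

theorem integral_abs_le_add_max_mul_integral_rpow {B l : ℝ} (hf : AEStronglyMeasurable f μ)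
    (hfB : ∀ᵐ x ∂μ, |f x| ≤ B) (hq : 0 ≤ q) (hl : 0 < l) :
    ∫ x, |f x| ∂μ ≤
      μ.real univ * l + max (l ^ (1 - q)) (B ^ (1 - q)) * ∫ x, |f x| ^ q ∂μ := by
  have hint : Integrable (fun x => |f x|) μ := (Integrable.of_bound hf B hfB).abs
  have hint' : Integrable (fun x => |f x| ^ q) μ := by
    refine .of_bound (C := B ^ q)
      ((Real.continuous_rpow_const hq).comp_aestronglyMeasurable hf.norm) ?_
    filter_upwards [hfB] with x hx
    rw [Real.norm_of_nonneg (by positivity)]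
    gcongr
  calc ∫ x, |f x| ∂μ ≤ ∫ x, (l + max (l ^ (1 - q)) (B ^ (1 - q)) * |f x| ^ q) ∂μ := by
        refine integral_mono_ae hint ((integrable_const _).add (hint'.const_mul _)) ?_
        filter_upwards [hfB] with x hx using le_add_max_mul_rpow q (abs_nonneg _) hx hl
    _ = _ := by
        rw [integral_add (integrable_const _) (hint'.const_mul _), integral_const,
          integral_const_mul, smul_eq_mul]

theorem div_max_le_integral_rpow {ε M V Λ : ℝ} (hf : AEStronglyMeasurable f μ) (hΛ : 0 < Λ)
    (hM : 0 ≤ M) (hfM : ∀ᵐ x ∂μ, |f x| ≤ M * Λ) (hq : 0 ≤ q) (hε : 0 < ε) (hV : 0 < V)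
    (hμ : μ.real univ ≤ V * Λ ^ (-q)) (hmass : ε * (Λ * Λ ^ (-q)) ≤ ∫ x, |f x| ∂μ) :
    ε / 2 / max ((ε / (2 * V)) ^ (1 - q)) (M ^ (1 - q)) ≤ ∫ x, |f x| ^ q ∂μ := by
  set m := max ((ε / (2 * V)) ^ (1 - q)) (M ^ (1 - q)) with hm
  have hm₀ : 0 < m := lt_max_of_lt_left (by positivity)
  have hle := integral_abs_le_add_max_mul_integral_rpow hf hfM hq
    (by positivity : 0 < ε / (2 * V) * Λ)
  have hvolume : μ.real univ * (ε / (2 * V) * Λ) ≤ ε / 2 * (Λ * Λ ^ (-q)) := by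
    calc _ ≤ V * Λ ^ (-q) * (ε / (2 * V) * Λ) := by gcongr
      _ = _ := by field_simp
  have hΛq : Λ * Λ ^ (-q) = Λ ^ (1 - q) := by
    rw [sub_eq_add_neg, Real.rpow_add hΛ, Real.rpow_one]
  rw [Real.mul_rpow (by positivity) hΛ.le, Real.mul_rpow hM hΛ.le,
    ← max_mul_of_nonneg _ _ (by positivity), ← hm] at hle
  rw [hΛq] at hmass hvolume
  rw [div_le_iff₀' hm₀]
  refine le_of_mul_le_mul_right ?_ (by positivity : 0 < Λ ^ (1 - q))
  linarith

end Integral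

section Concentration

variable {N : ℕ} {p M T : ℝ} {Ω : Set (EuclideanSpace ℝ (Fin N))}
  {u₀ : EuclideanSpace ℝ (Fin N) → ℝ} {u : ℝ → EuclideanSpace ℝ (Fin N) → ℝ}
  {a : EuclideanSpace ℝ (Fin N)}

theorem TypeIEstimate.ae_abs_le (hI : TypeIEstimate p Ω T M u) (hM : 0 ≤ M) {t : ℝ}
    (ht : t ∈ Ico 0 T) :
    ∀ᵐ x ∂volume.restrict Ω, |u t x| ≤ M * (T - t) ^ (-(1 / (p - 1))) := by
  have hτ : 0 < T - t := sub_pos.2 ht.2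
  filter_upwards [ae_le_eLpNormEssSup (f := u t) (μ := volume.restrict Ω)] with x hx
  have hle := hx.trans (eLpNorm_exponent_top (f := u t) ▸ hI t ht)
  rwa [Real.enorm_eq_ofReal_abs, ENNReal.ofReal_le_ofReal_iff (by positivity)] at hle

theorem IsBlowUpPoint.not_bounded (ha : IsBlowUpPoint Ω T u a) {r s B : ℝ} (hr : 0 < r)
    (hs : s < T) : ¬ ∀ t ∈ Ico s T, ∀ x ∈ Ω ∩ ball a r, |u t x| ≤ B := by
  intro hB
  have hle : limsup (fun z : ℝ × EuclideanSpace ℝ (Fin N) => ‖u z.1 z.2‖ₑ)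
      (𝓝[<] T ×ˢ 𝓝[Ω] a) ≤ ENNReal.ofReal B := by
    refine limsup_le_of_le (by isBoundedDefault) ?_
    filter_upwards [prod_mem_prod (Ico_mem_nhdsLT hs)
      (inter_mem_nhdsWithin Ω (ball_mem_nhds a hr))] with z hz
    rw [Real.enorm_eq_ofReal_abs]
    exact ENNReal.ofReal_le_ofReal (hB z.1 hz.1 z.2 hz.2)
  exact ENNReal.ofReal_ne_top (top_le_iff.1 (ha.2 ▸ hle))

namespace IsClassicalSolution

theorem continuousOn_space (hu : IsClassicalSolution p Ω u₀ T u) {t : ℝ} (ht : t ∈ Ioo 0 T) :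
    ContinuousOn (u t) (closure Ω) :=
  hu.continuousOn_closure.comp (f := fun x => (t, x)) (by fun_prop) fun _ hx => ⟨ht, hx⟩

theorem abs_le (hu : IsClassicalSolution p Ω u₀ T u) (hΩ : IsOpen Ω)
    (hI : TypeIEstimate p Ω T M u) (hM : 0 ≤ M) {t : ℝ} (ht : t ∈ Ioo 0 T)
    {x : EuclideanSpace ℝ (Fin N)} (hx : x ∈ closure Ω) :
    |u t x| ≤ M * (T - t) ^ (-(1 / (p - 1))) := by
  by_cases hxΩ : x ∈ Ω
  · have hae : (fun y => max |u t y| (M * (T - t) ^ (-(1 / (p - 1))))) =ᵐ[volume.restrict Ω]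
        fun _ => M * (T - t) ^ (-(1 / (p - 1))) := by
      filter_upwards [hI.ae_abs_le hM ⟨ht.1.le, ht.2⟩] with y hy using max_eq_right hy
    exact max_eq_right_iff.1 (Measure.eqOn_open_of_ae_eq hae hΩ
      (((hu.continuousOn_space ht).mono subset_closure).abs.sup continuousOn_const)
      continuousOn_const hxΩ)
  · have hτ : 0 < T - t := sub_pos.2 ht.2
    rw [hu.boundary t ht x (hΩ.frontier_eq ▸ ⟨hx, hxΩ⟩), abs_zero]
    positivity

theorem aestronglyMeasurable (hu : IsClassicalSolution p Ω u₀ T u) (hΩ : IsOpen Ω)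
    (hu₀ : AEStronglyMeasurable u₀ (volume.restrict Ω)) {t : ℝ} (ht : t ∈ Ico 0 T) :
    AEStronglyMeasurable (u t) (volume.restrict Ω) := by
  rcases ht.1.eq_or_lt with rfl | h0
  · exact hu₀.congr hu.initial.symm
  · exact ((hu.continuousOn_space ⟨h0, ht.2⟩).mono subset_closure).aestronglyMeasurable
      hΩ.measurableSet

theorem isRegularSolution_shift (hu : IsClassicalSolution p Ω u₀ T u) (hΩ : IsOpen Ω) {t₀ : ℝ}
    (ht₀ : t₀ ∈ Ioo 0 T) : IsRegularSolution p (T - t₀) Ω (fun t => u (t₀ + t)) := by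
  have hIco (t : ℝ) (ht : t ∈ Ico 0 (T - t₀)) : t₀ + t ∈ Ioo 0 T :=
    ⟨add_pos_of_pos_of_nonneg ht₀.1 ht.1, lt_sub_iff_add_lt'.1 ht.2⟩
  refine
  { isOpen := hΩ
    continuousOn := hu.continuousOn_closure.comp
      (f := fun z : ℝ × EuclideanSpace ℝ (Fin N) => (t₀ + z.1, z.2)) (by fun_prop)
      fun z hz => ⟨hIco z.1 hz.1, hz.2⟩
    boundary := fun t ht => hu.boundary _ (hIco t ht)
    differentiableAt_time := fun t ht x hx =>
      ((hu.differentiableAt_time _ (hIco t ⟨ht.1.le, ht.2⟩) x hx).hasDerivAt.comp_const_add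
        t₀ t).differentiableAt
    contDiffAt_space := fun t ht x hx =>
      (hu.contDiffOn_space _ (hIco t ⟨ht.1.le, ht.2⟩)).contDiffAt (hΩ.mem_nhds hx)
    equation := fun t ht x hx => ?_ }
  rw [deriv_comp_const_add (f := fun s => u s x), hu.equation _ (hIco t ⟨ht.1.le, ht.2⟩) x hx]

theorem tendsto_setIntegral_abs (hu : IsClassicalSolution p Ω u₀ T u) (hΩ : IsOpen Ω)
    (hu₀ : AEStronglyMeasurable u₀ (volume.restrict Ω)) (hI : TypeIEstimate p Ω T M u) (hM : 0 ≤ M)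
    (hT : 0 < T) {S : Set (EuclideanSpace ℝ (Fin N))} (hSΩ : S ⊆ Ω) (hS : Bornology.IsBounded S) :
    Tendsto (fun t => ∫ x in S, |u t x|) (𝓝[>] 0) (𝓝 (∫ x in S, |u 0 x|)) := by
  have hsub : volume.restrict S ≤ volume.restrict Ω := Measure.restrict_mono hSΩ le_rfl
  obtain ⟨R, hR, hSR⟩ := hS.subset_ball_lt 0 0
  have : IsFiniteMeasure (volume.restrict S) := isFiniteMeasure_restrict.2 hS.measure_lt_top.ne
  refine tendsto_integral_of_L1 _
    ((hu.aestronglyMeasurable hΩ hu₀ ⟨le_rfl, hT⟩).mono_measure hsub).norm ?_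
    (tendsto_of_tendsto_of_tendsto_of_le_of_le tendsto_const_nhds (hu.initial_limit R hR)
      (fun _ => zero_le) fun t => ?_)
  · filter_upwards [Ioo_mem_nhdsGT hT] with t ht
    have htI : t ∈ Ico 0 T := ⟨ht.1.le, ht.2⟩
    exact (Integrable.of_bound ((hu.aestronglyMeasurable hΩ hu₀ htI).mono_measure hsub) _
      (ae_mono hsub (hI.ae_abs_le hM htI))).abs
  · calc ∫⁻ x in S, ‖|u t x| - |u 0 x|‖ₑ ≤ ∫⁻ x in S, ‖u t x - u₀ x‖ₑ := by
          refine lintegral_mono_ae ?_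
          filter_upwards [ae_mono hsub hu.initial] with x hx
          rw [hx, Real.enorm_eq_ofReal_abs, Real.enorm_eq_ofReal_abs]
          exact ENNReal.ofReal_le_ofReal (abs_abs_sub_abs_le _ _)
      _ ≤ ∫⁻ x in Ω ∩ ball 0 R, ‖u t x - u₀ x‖ₑ := lintegral_mono_set (subset_inter hSΩ hSR)

end IsClassicalSolution

theorem exists_mass_lower_bound_of_pos (N : ℕ) {p M : ℝ} (hp : 1 < p) (hM : 0 ≤ M) :
    ∃ ε > 0, ∃ k > 0, ∀ (Ω : Set (EuclideanSpace ℝ (Fin N))) (u₀ : EuclideanSpace ℝ (Fin N) → ℝ)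
      (T : ℝ) (u : ℝ → EuclideanSpace ℝ (Fin N) → ℝ),
      IsOpen Ω → IsClassicalSolution p Ω u₀ T u → TypeIEstimate p Ω T M u →
      ∀ a, IsBlowUpPoint Ω T u a → ∀ t ∈ Ioo 0 T,
        ε * ((T - t) ^ (-(1 / (p - 1))) * √(T - t) ^ N) ≤
          ∫ x in Ω ∩ closedBall a (k * √(T - t)), |u t x| := by
  obtain ⟨ε, hε, k, hk, hregular⟩ := exists_abs_le_of_small_mass
    (volume : Measure (EuclideanSpace ℝ (Fin N))) hp hM
  refine ⟨ε, hε, k, hk, fun Ω u₀ T u hΩ hu hI a ha t ht => ?_⟩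
  by_contra! hmass
  obtain ⟨s, hs, r, hr, B, hB⟩ := hregular (T - t) Ω _ (sub_pos.2 ht.2)
    (hu.isRegularSolution_shift hΩ ht)
    (fun s hs x hx => by
      rw [sub_sub]
      exact hu.abs_le hΩ hI hM ⟨add_pos_of_pos_of_nonneg ht.1 hs.1, lt_sub_iff_add_lt'.1 hs.2⟩ hx)
    a (by simpa using hmass)
  refine ha.not_bounded (B := B) hr (lt_sub_iff_add_lt'.1 hs) fun t' ht' x hx => ?_
  simpa using hB (t' - t) ⟨by linarith [ht'.1], by linarith [ht'.2]⟩ x hx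

theorem exists_mass_lower_bound (N : ℕ) {p M : ℝ} (hp : 1 < p) (hM : 0 ≤ M) :
    ∃ ε > 0, ∃ k > 0, ∀ (Ω : Set (EuclideanSpace ℝ (Fin N))) (u₀ : EuclideanSpace ℝ (Fin N) → ℝ)
      (T : ℝ) (u : ℝ → EuclideanSpace ℝ (Fin N) → ℝ),
      IsOpen Ω → AEStronglyMeasurable u₀ (volume.restrict Ω) → IsClassicalSolution p Ω u₀ T u →
      TypeIEstimate p Ω T M u → ∀ a, IsBlowUpPoint Ω T u a → ∀ t ∈ Ico 0 T,
        ε * ((T - t) ^ (-(1 / (p - 1))) * √(T - t) ^ N) ≤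
          ∫ x in Ω ∩ closedBall a (k * √(T - t)), |u t x| := by
  obtain ⟨ε, hε, k, hk, hpos⟩ := exists_mass_lower_bound_of_pos N hp hM
  refine ⟨ε, hε, k, hk, fun Ω u₀ T u hΩ hu₀ hu hI a ha t ht => ?_⟩
  rcases ht.1.lt_or_eq with h0 | rfl
  · exact hpos Ω u₀ T u hΩ hu hI a ha t ⟨h0, ht.2⟩
  have hT : 0 < T := ht.2
  have hbound : Tendsto (fun t : ℝ => ε * ((T - t) ^ (-(1 / (p - 1))) * √(T - t) ^ N)) (𝓝[>] 0)
      (𝓝 (ε * ((T - 0) ^ (-(1 / (p - 1))) * √(T - 0) ^ N))) :=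
    (continuousAt_const.mul (.mul (.rpow_const (by fun_prop) (.inl (by simpa using hT.ne')))
      (by fun_prop))).mono_left nhdsWithin_le_nhds
  refine le_of_tendsto_of_tendsto hbound (hu.tendsto_setIntegral_abs hΩ hu₀ hI hM hT
    inter_subset_left (isBounded_closedBall.subset inter_subset_right)) ?_
  filter_upwards [Ioo_mem_nhdsGT hT] with t ht
  refine (hpos Ω u₀ T u hΩ hu hI a ha t ht).trans (setIntegral_mono_set ?_
    (.of_forall fun _ => abs_nonneg _) (LE.le.eventuallyLE (inter_subset_inter_right _
      (closedBall_subset_closedBall ?_))))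
  · exact ((((hu.continuousOn_space ht).abs.mono inter_subset_left).integrableOn_compact
      ((isCompact_closedBall _ _).inter_left isClosed_closure)).mono_set
        (inter_subset_inter_left _ subset_closure))
  · gcongr
    exact ht.1.le

theorem rpow_neg_typeI_rate (N : ℕ) {p τ : ℝ} (hp : 1 < p) (hτ : 0 < τ) :
    (τ ^ (-(1 / (p - 1)))) ^ (-((N : ℝ) * (p - 1) / 2)) = √τ ^ N := by
  have : p - 1 ≠ 0 := (sub_pos.2 hp).ne'
  rw [← Real.rpow_mul hτ.le, Real.sqrt_eq_rpow, ← Real.rpow_natCast, ← Real.rpow_mul hτ.le]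
  congr 1
  field_simp

theorem measureReal_inter_closedBall_le (Ω : Set (EuclideanSpace ℝ (Fin N))) (a) {k r : ℝ}
    (hk : 0 ≤ k) (hr : 0 ≤ r) :
    volume.real (Ω ∩ closedBall a (k * r)) ≤
      k ^ N * volume.real (ball (0 : EuclideanSpace ℝ (Fin N)) 1) * r ^ N := by
  refine (measureReal_mono inter_subset_right measure_closedBall_lt_top.ne).trans_eq ?_
  rw [measureReal_def, Measure.addHaar_closedBall _ _ (by positivity), ENNReal.toReal_mul,
    ENNReal.toReal_ofReal (by positivity), finrank_euclideanSpace_fin, measureReal_def]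
  ring

end Concentration

end SemilinearHeat

theorem lemma3p1_general (N : ℕ) {p : ℝ} (hp : 1 < p) {M : ℝ} (hM : 0 ≤ M) :
    ∃ η₁ > (0 : ℝ), ∃ k₁ > (0 : ℝ),
      ∀ (Ω : Set (EuclideanSpace ℝ (Fin N))) (u₀ : EuclideanSpace ℝ (Fin N) → ℝ) (T : ℝ)
        (u : ℝ → EuclideanSpace ℝ (Fin N) → ℝ),
        IsOpen Ω →
        AEStronglyMeasurable u₀ (volume.restrict Ω) →
        SemilinearHeat.IsClassicalSolution p Ω u₀ T u →
        SemilinearHeat.TypeIEstimate p Ω T M u →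
        ∀ a, SemilinearHeat.IsBlowUpPoint Ω T u a →
          ∀ t ∈ Set.Ico 0 T,
            η₁ ≤ ∫ x in Ω ∩ {x | ‖x - a‖ ≤ k₁ * √(T - t)},
              |u t x| ^ ((N : ℝ) * (p - 1) / 2) := by
  obtain ⟨ε, hε, k, hk, hmass⟩ := SemilinearHeat.exists_mass_lower_bound N hp hM
  set V := k ^ N * volume.real (Metric.ball (0 : EuclideanSpace ℝ (Fin N)) 1)
  have hV : 0 < V := mul_pos (pow_pos hk N) (SemilinearHeat.measureReal_unitBall_pos volume)
  set q := (N : ℝ) * (p - 1) / 2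
  have hq : 0 ≤ q := div_nonneg (mul_nonneg N.cast_nonneg (sub_nonneg.2 hp.le)) two_pos.le
  refine ⟨ε / 2 / max ((ε / (2 * V)) ^ (1 - q)) (M ^ (1 - q)),
    div_pos (half_pos hε) (lt_max_of_lt_left (by positivity)), k, hk,
    fun Ω u₀ T u hΩ hu₀ hu hI a ha t ht => ?_⟩
  have hball : {x | ‖x - a‖ ≤ k * √(T - t)} = Metric.closedBall a (k * √(T - t)) :=
    Set.ext fun x => mem_closedBall_iff_norm.symm
  rw [hball]
  have hτ : 0 < T - t := sub_pos.2 ht.2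
  have hsub : volume.restrict (Ω ∩ Metric.closedBall a (k * √(T - t))) ≤ volume.restrict Ω :=
    Measure.restrict_mono inter_subset_left le_rfl
  have : IsFiniteMeasure (volume.restrict (Ω ∩ Metric.closedBall a (k * √(T - t)))) :=
    isFiniteMeasure_restrict.2
      (measure_inter_lt_top_of_right_ne_top measure_closedBall_lt_top.ne).ne
  have hrate := SemilinearHeat.rpow_neg_typeI_rate N hp hτ
  refine SemilinearHeat.div_max_le_integral_rpow (Λ := (T - t) ^ (-(1 / (p - 1))))
    ((hu.aestronglyMeasurable hΩ hu₀ ht).mono_measure hsub) (by positivity) hM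
    (ae_mono hsub (hI.ae_abs_le hM ht)) hq hε hV ?_ ?_
  · rw [hrate, measureReal_restrict_apply_univ]
    exact SemilinearHeat.measureReal_inter_closedBall_le Ω a hk.le (Real.sqrt_nonneg _)
  · rw [hrate]
    exact hmass Ω u₀ T u hΩ hu₀ hu hI a ha t ht

theorem lemma3p1 (N : ℕ) (hN : 1 ≤ N) (p : ℝ) (hp : 1 < p) (M : ℝ) (hM : 0 < M) :
    ∃ η₁ > (0 : ℝ), ∃ k₁ > (0 : ℝ),
      ∀ (Ω : Set (EuclideanSpace ℝ (Fin N))) (u₀ : EuclideanSpace ℝ (Fin N) → ℝ) (T : ℝ)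
        (u : ℝ → EuclideanSpace ℝ (Fin N) → ℝ),
        SemilinearHeat.IsSmoothDomain Ω →
        MemLp u₀ ⊤ (volume.restrict Ω) →
        SemilinearHeat.IsBlowUpSolution p Ω u₀ T u →
        SemilinearHeat.TypeIEstimate p Ω T M u →
        ∀ a, SemilinearHeat.IsBlowUpPoint Ω T u a →
          ∀ t ∈ Set.Ico 0 T,
            η₁ ≤ ∫ x in Ω ∩ {x | ‖x - a‖ ≤ k₁ * √(T - t)},
              |u t x| ^ ((N : ℝ) * (p - 1) / 2) := by
  obtain ⟨η, hη, k, hk, h⟩ := lemma3p1_general N hp hM.le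
  exact ⟨η, hη, k, hk, fun Ω u₀ T u hΩ hu₀ hu =>
    h Ω u₀ T u hΩ.isOpen hu₀.aestronglyMeasurable hu.isClassicalSolution⟩
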